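/- For a real matrix $M$ with $n$ rows and $k$ columns let $\sigma_{\min}(M)$ denote its $\min\{k,n\}$-th largest singular value, i.e. $\sigma_{\min}(M)=\min_{x\in\mathbb R^k,\|x\|_2=1}\|Mx\|_2$ if $1\le k\le n$ and $\sigma_{\min}(M)=\min_{x\in\mathbb R^n,\|x\|_2=1}\|M^{\top}x\|_2$ if $k>n\ge 1$. For $A\in\mathbb R^{n\times m}$ and $S\subset[m]=\{1,\dots,m\}$ let $A_S$ be the submatrix of $A$ consisting of the columns indexed by $S$. **Theorem.** Let $A\in\mathbb R^{n\times m}$ have rank $n$, and let $k\le m$. There exists $S_0\subset[m]$ of size $k$ such that $$\sigma_{\min}(A_{S_0})^2\ \ge\ \begin{cases} g_1(n)\,\sigma_{\min}(A)^2 & \text{if } k=2,\ n\ge k,\\ g_2(n)\,\sigma_{\min}(A)^2 & \text{if } k=3,\ n\ge k,\\ g_1(k)\,\sigma_{\min}(A)^2 & \text{if } n=2,\ k\ge n,\\ g_2(k)\,\sigma_{\min}(A)^2 & \text{if } n=3,\ k\ge n,\end{cases}$$ where $$g_1(x)=\frac{x-\sqrt{x(m-x)/(m-1)}}{m}$$ and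 $$g_2(x)=\frac{x}{m}+\frac{2}{m}\sqrt{\frac{x(m-x)}{m-1}}\,\cos\!\left(\frac13\arccos\!\left(\frac{m-2x}{m-2}\sqrt{\frac{m-1}{x(m-x)}}\right)+\frac{2\pi}{3}\right),$$ with $g_2(m)=1$ (for $x=m$ the factor in front of the cosine vanishes, and the second summand is read as $0$). -/

import Mathlib

/-- The minimum of `‖M x‖₂` over the Euclidean unit vectors `x`, written as an infimum; it is
attained as soon as there is at least one column, see `exists_eq_minNormOnSphere`. -/
noncomputable def minNormOnSphere {ι κ : Type*} [Fintype ι] [Fintype κ]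
    (M : Matrix ι κ ℝ) : ℝ :=
  ⨅ x : Metric.sphere (0 : EuclideanSpace ℝ κ) 1, ‖WithLp.toLp 2 (M.mulVec x.1.ofLp)‖

/-- The infimum in `minNormOnSphere` is a minimum. -/
theorem exists_eq_minNormOnSphere {ι κ : Type*} [Fintype ι] [Fintype κ] [Nonempty κ]
    (M : Matrix ι κ ℝ) :
    ∃ x : EuclideanSpace ℝ κ, ‖x‖ = 1 ∧
      ‖WithLp.toLp 2 (M.mulVec x.ofLp)‖ = minNormOnSphere M ∧
      ∀ y : EuclideanSpace ℝ κ, ‖y‖ = 1 →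
        minNormOnSphere M ≤ ‖WithLp.toLp 2 (M.mulVec y.ofLp)‖ := by
  have hbdd : BddBelow (Set.range fun x : Metric.sphere (0 : EuclideanSpace ℝ κ) 1 =>
      ‖WithLp.toLp 2 (M.mulVec x.1.ofLp)‖) :=
    ⟨0, by rintro _ ⟨x, rfl⟩; exact norm_nonneg _⟩
  have hc : Continuous fun x : EuclideanSpace ℝ κ => ‖WithLp.toLp 2 (M.mulVec x.ofLp)‖ := by
    fun_prop
  have hne : (Metric.sphere (0 : EuclideanSpace ℝ κ) 1).Nonempty :=
    NormedSpace.sphere_nonempty.mpr zero_le_one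
  obtain ⟨x, hx, hmin⟩ :=
    (isCompact_sphere (0 : EuclideanSpace ℝ κ) 1).exists_isMinOn hne hc.continuousOn
  have : Nonempty (Metric.sphere (0 : EuclideanSpace ℝ κ) 1) := hne.to_subtype
  refine ⟨x, by simpa using hx, le_antisymm (le_ciInf fun y => hmin y.2) (ciInf_le hbdd ⟨x, hx⟩),
    fun y hy => ciInf_le hbdd ⟨y, by simpa using hy⟩⟩

/-- The `min{k, n}`-th largest singular value of a matrix with `n` rows and `k` columns:
the minimum of `‖M x‖₂` over unit vectors if `k ≤ n`, of `‖Mᵀ x‖₂` if `k > n`. -/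
noncomputable def sigmaMin {ι κ : Type*} [Fintype ι] [Fintype κ] (M : Matrix ι κ ℝ) : ℝ :=
  if Fintype.card κ ≤ Fintype.card ι then minNormOnSphere M else minNormOnSphere M.transpose

/-- The submatrix `A_S` consisting of the columns of `A` indexed by `S`. -/
def colSubmatrix {n m : ℕ} (A : Matrix (Fin n) (Fin m) ℝ) (S : Finset (Fin m)) :
    Matrix (Fin n) S ℝ :=
  A.submatrix id Subtype.val

/-- `g₁(x) = (x - √(x(m-x)/(m-1))) / m`. -/
noncomputable def g1 (m : ℕ) (x : ℝ) : ℝ :=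
  (x - Real.sqrt (x * (m - x) / (m - 1))) / m

/-- The trigonometric expression `g₂`. For `x = m` the argument of `arccos` is not
defined, but the factor in front of the cosine is zero, so the value is `1`. -/
noncomputable def g2 (m : ℕ) (x : ℝ) : ℝ :=
  x / m + 2 / m * Real.sqrt (x * (m - x) / (m - 1)) *
    Real.cos (1 / 3 * Real.arccos
      ((m - 2 * x) / (m - 2) * Real.sqrt ((m - 1) / (x * (m - x)))) + 2 * Real.pi / 3)

/-! Write `A = K * U`, where `U` has orthonormal rows and both `K` and `Kᵀ` expand lengths by at
least `sigmaMin A` (`exists_factorization`). It then suffices to treat `U`, and, as there are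
finitely many subsets, to reach every `y` strictly below the bound (`exists_finset_card_mul_le`).

Let d = min(k, n) and x = max(k, n). Averaged over all k-subsets, the characteristic polynomial of
the Gram matrix (k ≤ n) or of the frame operator (k ≥ n) of the chosen columns of `U` has degree d,
with elementary symmetric functions binom(d, r)·x(x-1)⋯(x-r+1) / (m(m-1)⋯(m-r+1)). Its smallest root
is `g1` for d = 2 and `g2` for d = 3 (`quadraticGT_of_lt_g1`, `cubicGT_of_lt_g2`). One needs a
single subset that does as well as the average.

For k = 2, 3 the first d elementary symmetric functions of the eigenvalues of `Uᵀ U - y` are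
positive; a pivot index and a Schur complement then give a positive definite principal submatrix of
size d (`exists_pos_minor_two`, `exists_pos_minor_three`).

For n = 2, 3 columns are deleted one at a time, keeping all roots of the averaged polynomial above
`y` (`exists_erase_expectedQuadraticGT`, `exists_erase_expectedCubicGT`). Averaging controls only
the value at `y`; real-rootedness along the rank-one path `M - t v vᵀ` controls the roots. -/

/-! ### Location of the roots of real-rooted cubics. -/

/-- `X³ - a X² + b X - c` has three nonnegative real roots. -/
def CubicNonnegRoots (a b c : ℝ) : Prop :=
  ∃ x y z : ℝ, 0 ≤ x ∧ x ≤ y ∧ y ≤ z ∧ a = x + y + z ∧ b = x * y + x * z + y * z ∧ c = x * y * z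

theorem CubicNonnegRoots.of_roots {x y z : ℝ} (hx : 0 ≤ x) (hy : 0 ≤ y) (hz : 0 ≤ z) :
    CubicNonnegRoots (x + y + z) (x * y + x * z + y * z) (x * y * z) := by
  rcases le_total x y with hxy | hxy <;> rcases le_total y z with hyz | hyz <;>
    rcases le_total x z with hxz | hxz
  · exact ⟨x, y, z, hx, hxy, hyz, by ring, by ring, by ring⟩
  · exact ⟨x, y, z, hx, hxy, hyz, by ring, by ring, by ring⟩
  · exact ⟨x, z, y, hx, hxz, hyz, by ring, by ring, by ring⟩
  · exact ⟨z, x, y, hz, hxz, hxy, by ring, by ring, by ring⟩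
  · exact ⟨y, x, z, hy, hxy, hxz, by ring, by ring, by ring⟩
  · exact ⟨y, z, x, hy, hyz, hxz, by ring, by ring, by ring⟩
  · exact ⟨z, y, x, hz, hyz, hxy, by ring, by ring, by ring⟩
  · exact ⟨z, y, x, hz, hyz, hxy, by ring, by ring, by ring⟩

/-- The elementary symmetric functions of the roots of `X³ - a X² + b X - c`, shifted by `y`,
are positive. If the roots are real, this says that they are greater than `y`. -/
def CubicGT (y a b c : ℝ) : Prop :=
  0 < a - 3 * y ∧ 0 < b - 2 * y * a + 3 * y ^ 2 ∧ 0 < c - y * b + y ^ 2 * a - y ^ 3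

-- Rolle's theorem: with g the given cubic, the new one is (X^t g)' / X^(t-1) up to a constant, and
-- X^t g has t + 3 real roots. With t = s - 2 this takes the average over k-subsets from `s` vectors
-- to `s + 1`.
open Polynomial in
theorem CubicNonnegRoots.polar {a b c : ℝ} (h : CubicNonnegRoots a b c) (t : ℕ) (ht : 1 ≤ t) :
    CubicNonnegRoots ((t + 2) / (t + 3) * a) ((t + 1) / (t + 3) * b) (t / (t + 3) * c) := by
  obtain ⟨x, y, z, hx, hxy, hyz, rfl, rfl, rfl⟩ := h
  obtain ⟨t, rfl⟩ : ∃ u, t = u + 1 := ⟨t - 1, by omega⟩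
  push_cast
  set s : ℝ := (t : ℝ) + 1 with hs
  have hs0 : 0 < s := by positivity
  set g : ℝ[X] := (X - C x) * (X - C y) * (X - C z) with hg
  set F : ℝ[X] := C s * g + X * derivative g with hF
  have hder : derivative (X ^ (t + 1) * g) = X ^ t * F := by
    rw [hF, derivative_mul, derivative_X_pow]
    simp only [hs, Nat.add_sub_cancel, map_add, map_natCast, map_one]
    push_cast
    ring
  have hgne : g ≠ 0 := by
    rw [hg]; exact mul_ne_zero (mul_ne_zero (X_sub_C_ne_zero _) (X_sub_C_ne_zero _)) (X_sub_C_ne_zero _)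
  have hcard : (X ^ (t + 1) * g).roots.card = t + 4 := by
    rw [roots_mul (mul_ne_zero (pow_ne_zero _ X_ne_zero) hgne), hg, roots_mul, roots_mul]
    · simp
    · exact mul_ne_zero (X_sub_C_ne_zero _) (X_sub_C_ne_zero _)
    · exact hgne
  have hFe : F = C (s + 3) * X ^ 3 + C (-(s + 2) * (x + y + z)) * X ^ 2 +
      C ((s + 1) * (x * y + x * z + y * z)) * X + C (-s * (x * y * z)) := by
    rw [hF, hg]
    simp only [derivative_mul, derivative_sub, derivative_X, derivative_C, map_add, map_mul,
      map_neg, map_one, map_ofNat]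
    ring
  have hdeg : F.natDegree = 3 := by
    rw [hFe]; exact natDegree_cubic (by positivity)
  have hlead : F.leadingCoeff = s + 3 := by
    rw [hFe]; exact leadingCoeff_cubic (by positivity)
  have hFne : F ≠ 0 := by rintro h; rw [h] at hdeg; simp at hdeg
  have hle := card_roots_le_derivative (X ^ (t + 1) * g)
  rw [hder, hcard, roots_mul (mul_ne_zero (pow_ne_zero _ X_ne_zero) hFne)] at hle
  simp only [roots_X_pow, Multiset.card_add, Multiset.card_nsmul, Multiset.card_singleton] at hle
  have hle' := card_roots' F
  have hF3 : F.roots.card = 3 := by simp at hle; omega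
  obtain ⟨u, v, w, huvw⟩ := Multiset.card_eq_three.1 hF3
  have hprod := C_leadingCoeff_mul_prod_multiset_X_sub_C (p := F) (by rw [hF3, hdeg])
  rw [huvw, hlead] at hprod
  simp only [Multiset.insert_eq_cons, Multiset.map_cons, Multiset.map_singleton,
    Multiset.prod_cons, Multiset.prod_singleton] at hprod
  rw [hFe] at hprod
  have hev : ∀ r : ℝ, (s + 3) * ((r - u) * ((r - v) * (r - w))) =
      (s + 3) * r ^ 3 - (s + 2) * (x + y + z) * r ^ 2 +
        (s + 1) * (x * y + x * z + y * z) * r - s * (x * y * z) := by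
    intro r
    have := congrArg (eval r) hprod
    simp only [eval_mul, eval_add, eval_pow, eval_C, eval_X, eval_sub] at this
    linarith
  have hy : 0 ≤ y := hx.trans hxy
  have hz : 0 ≤ z := hy.trans hyz
  -- The coefficients alternate in sign, so the cubic is negative on the negative axis.
  have hroot : ∀ r : ℝ, (r - u) * ((r - v) * (r - w)) = 0 → 0 ≤ r := by
    intro r hr
    by_contra! hneg
    have h1 := hev r
    rw [hr, mul_zero] at h1
    have e1 : 0 < (s + 3) * (-r) ^ 3 := by have : 0 < -r := by linarith
                                           positivity
    have e2 : 0 ≤ (s + 2) * (x + y + z) * r ^ 2 := by positivity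
    have e3 : 0 ≤ (s + 1) * (x * y + x * z + y * z) * (-r) := by
      have : 0 < -r := by linarith
      positivity
    have e4 : 0 ≤ s * (x * y * z) := by positivity
    nlinarith
  -- The leading coefficients agree; the values at 0, 1 and -1 give the other three.
  have h0 := hev 0
  have h1 := hev 1
  have h2 := hev (-1)
  have key := CubicNonnegRoots.of_roots (hroot u (by ring)) (hroot v (by ring)) (hroot w (by ring))
  have hs3 : s + 3 ≠ 0 := by positivity
  convert key using 1
  · field_simp
    linarith
  · field_simp
    linarith
  · field_simp
    linarith

/-- At the smallest root `p` the polar cubic equals p(q-p)(r-p)/(s+3) ≥ 0, while a cubic with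
positive shifted symmetric functions is negative on (-∞, y]. Hence y < p. -/
theorem CubicGT.of_polar {y a b c s : ℝ} (hs : 0 < s) (h : CubicNonnegRoots a b c)
    (hgt : CubicGT y ((s + 2) / (s + 3) * a) ((s + 1) / (s + 3) * b) (s / (s + 3) * c)) :
    CubicGT y a b c := by
  obtain ⟨p, q, r, hp, hpq, hqr, rfl, rfl, rfl⟩ := h
  obtain ⟨h1, h2, h3⟩ := hgt
  have hpy : y < p := by
    by_contra! hle
    set A := (s + 2) / (s + 3) * (p + q + r) with hA
    set B := (s + 1) / (s + 3) * (p * q + p * r + q * r) with hB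
    set D := s / (s + 3) * (p * q * r) with hD
    have e : p ^ 3 - A * p ^ 2 + B * p - D = p * ((q - p) * (r - p)) / (s + 3) := by
      rw [hA, hB, hD]; field_simp; ring
    have e0 : 0 ≤ p ^ 3 - A * p ^ 2 + B * p - D := by
      rw [e]
      have : 0 ≤ q - p := by linarith
      have : 0 ≤ r - p := by linarith
      positivity
    have t0 : 0 ≤ y - p := by linarith
    have k1 := mul_nonneg h2.le t0
    have k2 := mul_nonneg h1.le (pow_nonneg t0 2)
    have k3 := pow_nonneg t0 3
    nlinarith
  have hq : 0 < q - y := by linarith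
  have hr : 0 < r - y := by linarith
  have hp' : 0 < p - y := by linarith
  refine ⟨by linarith, ?_, ?_⟩
  · have : 0 < (p - y) * (q - y) + (p - y) * (r - y) + (q - y) * (r - y) := by positivity
    nlinarith
  · have : 0 < (p - y) * (q - y) * (r - y) := by positivity
    nlinarith

/-- For d ≤ 0 the monic cubic in d with roots p-y, q-y, r-y is at most minus its third symmetric
function, hence negative; so these three real roots are positive. -/
theorem CubicNonnegRoots.gt_of_nonneg {y a b c : ℝ} (h : CubicNonnegRoots a b c)
    (h1 : 0 ≤ a - 3 * y) (h2 : 0 ≤ b - 2 * y * a + 3 * y ^ 2)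
    (h3 : 0 < c - y * b + y ^ 2 * a - y ^ 3) : CubicGT y a b c := by
  obtain ⟨p, q, r, hp, hpq, hqr, rfl, rfl, rfl⟩ := h
  have key : ∀ d : ℝ, (d - (p - y)) * (d - (q - y)) * (d - (r - y)) = 0 → 0 < d := by
    intro d hd
    by_contra! hle
    have k1 := mul_nonneg h2 (neg_nonneg.2 hle)
    have k2 := mul_nonneg h1 (sq_nonneg d)
    have k3 := pow_nonneg (neg_nonneg.2 hle) 3
    nlinarith
  have hp' := key (p - y) (by ring)
  have hq' := key (q - y) (by ring)
  have hr' := key (r - y) (by ring)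
  refine ⟨by linarith, ?_, h3⟩
  have : 0 < (p - y) * (q - y) + (p - y) * (r - y) + (q - y) * (r - y) := by positivity
  nlinarith

/-- An affine function that is positive at `0` and nonpositive at `u ≥ 0` has a zero in `[0, u]`. -/
theorem exists_affine_root {p q u : ℝ} (hp : 0 < p) (hu : 0 ≤ u) (h : (1 - u) * p + u * q ≤ 0) :
    ∃ v, 0 ≤ v ∧ v ≤ u ∧ (1 - v) * p + v * q = 0 := by
  have hc : ContinuousOn (fun v : ℝ => (1 - v) * p + v * q) (Set.Icc 0 u) := by fun_prop
  obtain ⟨v, hv, hv0⟩ := intermediate_value_Icc' hu hc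
    (show (0 : ℝ) ∈ Set.Icc _ _ from ⟨h, by simpa using hp.le⟩)
  exact ⟨v, hv.1, hv.2, hv0⟩

/-- Continuity in place of interlacing: the third shifted function is affine and positive at both
ends, hence throughout. Neither of the other two can reach zero while both are nonnegative, since
`gt_of_nonneg` would make them positive there. -/
theorem CubicGT.of_segment {y a b c a' b' c' : ℝ} (h : CubicGT y a b c)
    (hroots : ∀ t : ℝ, 0 ≤ t → t ≤ 1 → CubicNonnegRoots ((1 - t) * a + t * a')
      ((1 - t) * b + t * b') ((1 - t) * c + t * c'))
    (h3 : 0 < c' - y * b' + y ^ 2 * a' - y ^ 3) : CubicGT y a' b' c' := by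
  obtain ⟨g1, g2, g3⟩ := h
  have step : ∀ t : ℝ, 0 ≤ t → t ≤ 1 →
      0 ≤ (1 - t) * (a - 3 * y) + t * (a' - 3 * y) →
      0 ≤ (1 - t) * (b - 2 * y * a + 3 * y ^ 2) + t * (b' - 2 * y * a' + 3 * y ^ 2) →
      0 < (1 - t) * (a - 3 * y) + t * (a' - 3 * y) ∧
      0 < (1 - t) * (b - 2 * y * a + 3 * y ^ 2) + t * (b' - 2 * y * a' + 3 * y ^ 2) := by
    intro t h0 h1 ha hb
    have hpos : 0 < (1 - t) * (c - y * b + y ^ 2 * a - y ^ 3) +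
        t * (c' - y * b' + y ^ 2 * a' - y ^ 3) := by
      rcases h0.eq_or_lt with rfl | h0
      · simpa using g3
      · have := mul_pos h0 h3
        have := mul_nonneg (sub_nonneg.2 h1) g3.le
        linarith
    obtain ⟨k1, k2, -⟩ := (hroots t h0 h1).gt_of_nonneg (y := y) (by linarith) (by linarith)
      (by linarith)
    exact ⟨by linarith, by linarith⟩
  have claim : ∀ t : ℝ, 0 ≤ t → t ≤ 1 →
      0 ≤ (1 - t) * (a - 3 * y) + t * (a' - 3 * y) →
      0 < (1 - t) * (b - 2 * y * a + 3 * y ^ 2) + t * (b' - 2 * y * a' + 3 * y ^ 2) := by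
    intro t h0 h1 ha
    by_contra! hle
    obtain ⟨v, v0, vt, hv⟩ := exists_affine_root g2 h0 hle
    have hva : 0 ≤ (1 - v) * (a - 3 * y) + v * (a' - 3 * y) := by
      rcases le_total 0 (a' - 3 * y) with h' | h'
      · have := mul_nonneg (by linarith : 0 ≤ 1 - v) g1.le
        have := mul_nonneg v0 h'
        linarith
      · nlinarith
    have := (step v v0 (vt.trans h1) hva hv.ge).2
    linarith
  have ha' : 0 < a' - 3 * y := by
    by_contra! hle
    obtain ⟨v, v0, v1, hv⟩ := exists_affine_root g1 zero_le_one
      (show (1 - 1) * (a - 3 * y) + 1 * (a' - 3 * y) ≤ 0 by linarith)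
    have := (step v v0 v1 hv.ge (claim v v0 v1 hv.ge).le).1
    linarith
  have hb' := claim 1 zero_le_one le_rfl (by linarith)
  exact ⟨ha', by linarith, h3⟩

/-! ### The same for quadratics. -/

/-- `X² - a X + b` has two nonnegative real roots. -/
def QuadraticNonnegRoots (a b : ℝ) : Prop :=
  0 ≤ a ∧ 0 ≤ b ∧ 4 * b ≤ a ^ 2

/-- The elementary symmetric functions of the roots of `X² - a X + b`, shifted by `y`,
are positive. If the roots are real, this says that they are greater than `y`. -/
def QuadraticGT (y a b : ℝ) : Prop :=
  0 < a - 2 * y ∧ 0 < b - y * a + y ^ 2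

theorem QuadraticNonnegRoots.polar {a b s : ℝ} (hs : 0 < s) (h : QuadraticNonnegRoots a b) :
    QuadraticNonnegRoots ((s + 1) / (s + 2) * a) (s / (s + 2) * b) := by
  obtain ⟨ha, hb, hab⟩ := h
  refine ⟨by positivity, by positivity, ?_⟩
  have e : ((s + 1) / (s + 2) * a) ^ 2 - 4 * (s / (s + 2) * b) =
      (s * (s + 2) * (a ^ 2 - 4 * b) + a ^ 2) / (s + 2) ^ 2 := by
    field_simp; ring
  have : 0 ≤ a ^ 2 - 4 * b := by linarith
  have : 0 ≤ (s * (s + 2) * (a ^ 2 - 4 * b) + a ^ 2) / (s + 2) ^ 2 := by positivity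
  linarith

/-- At the smaller root `p` the polar quadratic is -p·d/(s+2) ≤ 0, while a quadratic with positive
shifted symmetric functions is positive on (-∞, y]. -/
theorem QuadraticGT.of_polar {y a b s : ℝ} (hs : 0 < s) (h : QuadraticNonnegRoots a b)
    (hgt : QuadraticGT y ((s + 1) / (s + 2) * a) (s / (s + 2) * b)) : QuadraticGT y a b := by
  obtain ⟨ha, hb, hab⟩ := h
  obtain ⟨h1, h2⟩ := hgt
  set d := Real.sqrt (a ^ 2 - 4 * b) with hd
  have hd2 : d ^ 2 = a ^ 2 - 4 * b := Real.sq_sqrt (by linarith)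
  have hd0 : 0 ≤ d := Real.sqrt_nonneg _
  have hda : d ≤ a := by nlinarith
  set p := (a - d) / 2 with hp
  have hp0 : 0 ≤ p := by rw [hp]; linarith
  have hpy : y < p := by
    by_contra! hle
    set A := (s + 1) / (s + 2) * a with hA
    set B := s / (s + 2) * b with hB
    have hb' : b = (a ^ 2 - d ^ 2) / 4 := by linarith
    have e : p ^ 2 - A * p + B = -(p * d) / (s + 2) := by
      rw [hA, hB, hb', hp]; field_simp; ring
    have e0 : p ^ 2 - A * p + B ≤ 0 := by
      rw [e]
      have : 0 ≤ p * d / (s + 2) := by positivity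
      rw [neg_div]; linarith
    have t0 : 0 ≤ y - p := by linarith
    have k1 := mul_nonneg h1.le t0
    have k2 := sq_nonneg (y - p)
    nlinarith
  refine ⟨by linarith, ?_⟩
  have k : 0 < (p - y) * (p + d - y) := mul_pos (by linarith) (by linarith)
  have e : (p - y) * (p + d - y) = (a ^ 2 - d ^ 2) / 4 - y * a + y ^ 2 := by rw [hp]; ring
  linarith

theorem QuadraticGT.of_segment {y a b a' b' : ℝ} (h : QuadraticGT y a b)
    (hroots : ∀ t : ℝ, 0 ≤ t → t ≤ 1 → QuadraticNonnegRoots ((1 - t) * a + t * a')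
      ((1 - t) * b + t * b'))
    (h2 : 0 < b' - y * a' + y ^ 2) : QuadraticGT y a' b' := by
  obtain ⟨g1, g2⟩ := h
  refine ⟨?_, h2⟩
  by_contra! hle
  obtain ⟨v, v0, v1, hv⟩ := exists_affine_root g1 zero_le_one
    (show (1 - 1) * (a - 2 * y) + 1 * (a' - 2 * y) ≤ 0 by linarith)
  have hpos : 0 < (1 - v) * (b - y * a + y ^ 2) + v * (b' - y * a' + y ^ 2) := by
    rcases v0.eq_or_lt with rfl | h0
    · simpa using g2
    · have := mul_pos h0 h2
      have := mul_nonneg (sub_nonneg.2 v1) g2.le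
      linarith
  -- At `v` the mean of the roots is `y`, so a nonnegative discriminant makes the value at `y`
  -- nonpositive, against `hpos`.
  obtain ⟨-, -, k⟩ := hroots v v0 v1
  have e : (1 - v) * a + v * a' = 2 * y := by linarith
  rw [e] at k
  have e' : y * ((1 - v) * a + v * a') = y * (2 * y) := by rw [e]
  linarith

/-! ### `g1` and `g2` as smallest roots. -/

/-- The roots of this quadratic are (x ± R)/m, with R the radical in `g1`. -/
theorem quadraticGT_of_lt_g1 {m : ℕ} {x y : ℝ} (hm : 2 ≤ m) (hx : 0 ≤ x) (hxm : x ≤ m)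
    (hy : y < g1 m x) : QuadraticGT y (2 * (x / m)) (x * (x - 1) / (m * (m - 1))) := by
  have hm' : (2 : ℝ) ≤ m := by exact_mod_cast hm
  have hm0 : (0 : ℝ) < m := by linarith
  have hm1 : (0 : ℝ) < m - 1 := by linarith
  set R := Real.sqrt (x * (m - x) / (m - 1)) with hR
  have hR0 : 0 ≤ R := Real.sqrt_nonneg _
  have hR2 : R ^ 2 = x * (m - x) / (m - 1) :=
    Real.sq_sqrt (div_nonneg (mul_nonneg hx (by linarith)) hm1.le)
  have hy' : y < (x - R) / m := hy
  rw [lt_div_iff₀ hm0] at hy'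
  have e : x * (x - 1) / (m * (m - 1)) = (x ^ 2 - R ^ 2) / m ^ 2 := by
    rw [hR2]; field_simp; ring
  rw [QuadraticGT, e]
  have e1 : 2 * (x / m) - 2 * y = 2 * (x - y * m) / m := by field_simp
  have e2 : (x ^ 2 - R ^ 2) / m ^ 2 - y * (2 * (x / m)) + y ^ 2 =
      (x - R - y * m) * (x + R - y * m) / m ^ 2 := by field_simp; ring
  rw [e1, e2]
  have p1 : 0 < x - R - y * m := by linarith
  have p2 : 0 < x + R - y * m := by linarith
  have p3 : 0 < x - y * m := by linarith
  constructor <;> positivity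

/-- Viète's trigonometric solution: X = (x + z)/m gives the depressed cubic z³ - 3R²z -
2R²(m-2x)/(m-2), and z = 2R cos φ turns it into an equation for cos 3φ. The shift 2π/3 puts φ in
[2π/3, π], which selects the smallest root. -/
theorem cubicGT_of_lt_g2 {m : ℕ} {x y : ℝ} (hm : 3 ≤ m) (hx : 1 ≤ x)
    (hxm : x ≤ m - 1 ∨ x = m) (hy : y < g2 m x) :
    CubicGT y (3 * (x / m)) (3 * (x * (x - 1) / (m * (m - 1))))
      (x * (x - 1) * (x - 2) / (m * (m - 1) * (m - 2))) := by
  have hm' : (3 : ℝ) ≤ m := by exact_mod_cast hm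
  have hm0 : (0 : ℝ) < m := by linarith
  have hm1 : (0 : ℝ) < m - 1 := by linarith
  have hm2 : (0 : ℝ) < m - 2 := by linarith
  have hx0 : 0 < x := by linarith
  have hxm' : 0 ≤ m - x := by rcases hxm with h | h <;> linarith
  set R := Real.sqrt (x * (m - x) / (m - 1)) with hR
  have hR0 : 0 ≤ R := Real.sqrt_nonneg _
  have hR2 : R ^ 2 = x * (m - x) / (m - 1) :=
    Real.sq_sqrt (div_nonneg (mul_nonneg hx0.le hxm') hm1.le)
  set u := (m - 2 * x) / (m - 2) * Real.sqrt ((m - 1) / (x * (m - x))) with hu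
  set θ := Real.arccos u with hθ
  set φ := 1 / 3 * θ + 2 * Real.pi / 3 with hφ
  have hθ0 : 0 ≤ θ := Real.arccos_nonneg _
  have hθπ : θ ≤ Real.pi := Real.arccos_le_pi _
  have hy' : y < x / m + 2 / m * R * Real.cos φ := hy
  have hc : Real.cos φ ≤ -1 / 2 := by
    have h1 : Real.cos φ ≤ Real.cos (2 * Real.pi / 3) :=
      Real.cos_le_cos_of_nonneg_of_le_pi (by positivity) (by rw [hφ]; linarith)
        (by rw [hφ]; linarith)
    have h2 : Real.cos (2 * Real.pi / 3) = -1 / 2 := by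
      rw [show 2 * Real.pi / 3 = Real.pi - Real.pi / 3 by ring, Real.cos_pi_sub,
        Real.cos_pi_div_three]
      norm_num
    linarith
  have hcos3 : R ^ 3 * (4 * Real.cos φ ^ 3 - 3 * Real.cos φ) = R ^ 2 * ((m - 2 * x) / (m - 2)) := by
    rcases hxm with hxm | hxm
    · have hmx : 0 < m - x := by linarith
      have hRpos : 0 < R := Real.sqrt_pos.2 (by positivity)
      have hsq : Real.sqrt ((m - 1) / (x * (m - x))) = 1 / R := by
        rw [hR, one_div, ← Real.sqrt_inv, inv_div]
      have hu2 : u = (m - 2 * x) / (m - 2) / R := by rw [hu, hsq]; ring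
      have husq : u ^ 2 ≤ 1 := by
        -- This is (x-1)(m-1-x) ≥ 0. It keeps the argument of `arccos` in [-1, 1], and would fail
        -- for x strictly between m-1 and m.
        have hp : (m : ℝ) - 1 ≤ x * (m - x) := by nlinarith
        have : u ^ 2 = 1 - m ^ 2 * (x * (m - x) - (m - 1)) / ((m - 2) ^ 2 * (x * (m - x))) := by
          rw [hu2, div_pow, hR2]; field_simp; ring
        rw [this]
        have : 0 ≤ (m : ℝ) ^ 2 * (x * (m - x) - (m - 1)) / ((m - 2) ^ 2 * (x * (m - x))) :=
          div_nonneg (mul_nonneg (by positivity) (by linarith)) (by positivity)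
        linarith
      have hcosθ : Real.cos θ = u := Real.cos_arccos (by nlinarith) (by nlinarith)
      rw [← Real.cos_three_mul, show 3 * φ = θ + 2 * Real.pi by rw [hφ]; ring,
        Real.cos_add_two_pi, hcosθ, hu2]
      field_simp
    · have : R = 0 := by rw [hR, hxm]; simp
      simp [this]
  set w := R * Real.cos φ with hw
  have hwR : 2 * w ≤ -R := by rw [hw]; nlinarith
  have hw3 : 4 * w ^ 3 - 3 * R ^ 2 * w = R ^ 2 * ((m - 2 * x) / (m - 2)) := by
    rw [← hcos3, hw]; ring
  -- `z` is the distance of `y` from the centre, `2 * w` the smallest root of the depressed cubic.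
  set z := y * m - x with hz
  have hyz : y = (x + z) / m := by rw [hz]; field_simp; ring
  have hzw : z < 2 * w := by
    have e : x / m + 2 / m * R * Real.cos φ = (x + 2 * w) / m := by rw [hw]; field_simp
    rw [e, lt_div_iff₀ hm0] at hy'
    linarith
  have hzneg : z < -R := by linarith
  have e2 : 3 * (x * (x - 1) / (m * (m - 1))) = 3 * (x ^ 2 - R ^ 2) / m ^ 2 := by
    rw [hR2]; field_simp; ring
  have e3 : x * (x - 1) * (x - 2) / (m * (m - 1) * (m - 2)) =
      (x ^ 3 - 3 * R ^ 2 * x + 2 * (R ^ 2 * ((m - 2 * x) / (m - 2)))) / m ^ 3 := by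
    rw [hR2]; field_simp; ring
  rw [CubicGT, e2, e3, ← hw3, hyz]
  have q1 : 3 * (x / m) - 3 * ((x + z) / m) = 3 * (-z) / m := by field_simp; ring
  have q2 : 3 * (x ^ 2 - R ^ 2) / m ^ 2 - 2 * ((x + z) / m) * (3 * (x / m)) +
      3 * ((x + z) / m) ^ 2 = 3 * ((-z - R) * (-z + R)) / m ^ 2 := by field_simp; ring
  have q3 : (x ^ 3 - 3 * R ^ 2 * x + 2 * (4 * w ^ 3 - 3 * R ^ 2 * w)) / m ^ 3 -
      (x + z) / m * (3 * (x ^ 2 - R ^ 2) / m ^ 2) + ((x + z) / m) ^ 2 * (3 * (x / m)) -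
      ((x + z) / m) ^ 3 =
      (2 * w - z) * (z ^ 2 + 2 * w * z + 4 * w ^ 2 - 3 * R ^ 2) / m ^ 3 := by field_simp; ring
  rw [q1, q2, q3]
  have r1 : 0 < -z := by linarith
  have r2 : 0 < -z - R := by linarith
  have r3 : 0 < -z + R := by linarith
  have r4 : 0 < 2 * w - z := by linarith
  have r5 : 0 < z ^ 2 + 2 * w * z + 4 * w ^ 2 - 3 * R ^ 2 := by
    have s1 : R ^ 2 ≤ (-(2 * w)) ^ 2 := pow_le_pow_left₀ hR0 (by linarith) 2
    have s2 : 0 ≤ -(2 * w) * (2 * w - z) := mul_nonneg (by linarith) r4.le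
    have s3 : 0 < (2 * w - z) ^ 2 := by positivity
    linarith
  refine ⟨by positivity, by positivity, by positivity⟩

/-! ### Positive definite principal submatrices of size two and three. -/

theorem exists_pos_of_sum_pos {ι : Type*} {s : Finset ι} {f : ι → ℝ} (h : 0 < ∑ i ∈ s, f i) :
    ∃ i ∈ s, 0 < f i := by
  by_contra! hle
  exact h.not_ge (Finset.sum_nonpos hle)

/-- A symmetric array `C` with positive first and second elementary symmetric functions of its
eigenvalues has a `2 × 2` principal submatrix with positive leading minors. -/
theorem exists_pos_minor_two {ι : Type*} [Fintype ι] (C : ι → ι → ℝ)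
    (h1 : 0 < ∑ i, C i i) (h2 : 0 < ∑ i, ∑ j, (C i i * C j j - C i j ^ 2)) :
    ∃ i j, 0 < C i i ∧ 0 < C i i * C j j - C i j ^ 2 := by
  obtain ⟨i, -, hi⟩ := exists_pos_of_sum_pos h2
  obtain ⟨j, -, hj⟩ := exists_pos_of_sum_pos hi
  refine ⟨i, j, ?_, hj⟩
  -- Dropping the squares leaves `C i i` times the positive trace.
  rw [Finset.sum_sub_distrib, ← Finset.mul_sum] at hi
  have hsq : 0 ≤ ∑ j, C i j ^ 2 := Finset.sum_nonneg fun j _ => sq_nonneg _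
  exact pos_of_mul_pos_left (by linarith : 0 < C i i * ∑ j, C j j) h1.le

/-- The principal `3 × 3` minor of a symmetric array. -/
def symMinor {ι : Type*} (C : ι → ι → ℝ) (i j l : ι) : ℝ :=
  C i i * (C j j * C l l - C j l ^ 2) - C i j * (C i j * C l l - C j l * C i l) +
    C i l * (C i j * C j l - C j j * C i l)

/-- The index `i` stays fixed because it becomes the pivot in `exists_pos_minor_three`; summing over
`i` afterwards gives Newton's identity. -/
theorem sum_sum_symMinor {ι : Type*} [Fintype ι] (C : ι → ι → ℝ) (i : ι) :
    ∑ j, ∑ l, symMinor C i j l = C i i * ((∑ j, C j j) ^ 2 - ∑ j, ∑ l, C j l ^ 2) -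
      2 * (∑ j, C j j) * (∑ j, C i j ^ 2) + 2 * ∑ j, ∑ l, C i j * C i l * C j l := by
  have e : ∀ j l, symMinor C i j l = C i i * (C j j * C l l) - C i i * C j l ^ 2
      - C i j ^ 2 * C l l - C j j * C i l ^ 2 + 2 * (C i j * C i l * C j l) := by
    intro j l; unfold symMinor; ring
  simp only [e, Finset.sum_add_distrib, Finset.sum_sub_distrib, ← Finset.mul_sum,
    ← Finset.sum_mul]
  ring

/-- A symmetric array whose first three elementary symmetric functions of the eigenvalues are
positive has a `3 × 3` principal submatrix with positive leading minors. -/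
theorem exists_pos_minor_three {ι : Type*} [Fintype ι] (C : ι → ι → ℝ)
    (h1 : 0 < ∑ i, C i i) (h2 : 0 < ∑ i, ∑ j, (C i i * C j j - C i j ^ 2))
    (h3 : 0 < ∑ i, ∑ j, ∑ l, symMinor C i j l) :
    ∃ i j l, 0 < C i i ∧ 0 < C i i * C j j - C i j ^ 2 ∧ 0 < symMinor C i j l := by
  obtain ⟨i, -, hi⟩ := exists_pos_of_sum_pos h3
  have hi' := hi
  rw [sum_sum_symMinor] at hi'
  set t := ∑ j, C j j with ht
  set T := ∑ j, ∑ l, C j l ^ 2 with hT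
  set p := ∑ j, C i j ^ 2 with hp
  set q := ∑ j, ∑ l, C i j * C i l * C j l with hq
  have hp0 : 0 ≤ p := Finset.sum_nonneg fun j _ => sq_nonneg _
  have hT0 : 0 ≤ T := Finset.sum_nonneg fun j _ => Finset.sum_nonneg fun j _ => sq_nonneg _
  have h2' : 0 < t ^ 2 - T := by
    simp only [Finset.sum_sub_distrib, ← Finset.mul_sum, ← Finset.sum_mul] at h2
    rw [sq]; exact h2
  have hcs : q ^ 2 ≤ p ^ 2 * T := by
    have := Finset.sum_mul_sq_le_sq_mul_sq (Finset.univ ×ˢ Finset.univ : Finset (ι × ι))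
      (fun x => C i x.1 * C i x.2) (fun x => C x.1 x.2)
    simp only [Finset.sum_product, mul_pow] at this
    simp only [← Finset.mul_sum, ← Finset.sum_mul] at this
    rw [sq p]
    exact this
  -- Multiplied by `p`, this is at least (tp - q)² by `hcs`.
  have hpq : 0 ≤ (t ^ 2 + T) * p - 2 * t * q := by
    rcases hp0.eq_or_lt with h0 | h0
    · rw [← h0] at hcs ⊢
      have : q = 0 := by nlinarith
      simp [this]
    · by_contra! hneg
      have := mul_neg_of_neg_of_pos hneg h0
      nlinarith [sq_nonneg (t * p - q)]
  -- (t² - T)(C i i · t - p) is `t` times the minor sum in `hi'` plus the quantity in `hpq`.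
  have hD2 : 0 < C i i * t - p := by
    have h := mul_pos h1 hi'
    exact pos_of_mul_pos_right (by nlinarith : 0 < (t ^ 2 - T) * (C i i * t - p)) h2'.le
  have hii : 0 < C i i := pos_of_mul_pos_left (by linarith : 0 < C i i * t) h1.le
  -- Schur complement of the pivot: its diagonal entries and 2 × 2 minors are the minors of `C`
  -- through `i` divided by `C i i`, which reduces to size two.
  set C' : ι → ι → ℝ := fun j l => C j l - C i j * C i l / C i i with hC'
  have e1 : ∀ j, C' j j = (C i i * C j j - C i j ^ 2) / C i i := by
    intro j; simp only [hC']; field_simp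
  have e2 : ∀ j l, C' j j * C' l l - C' j l ^ 2 = symMinor C i j l / C i i := by
    intro j l; simp only [hC', symMinor]; field_simp; ring
  obtain ⟨j, l, hj, hl⟩ := exists_pos_minor_two C'
    (by
      simp only [e1]
      rw [← Finset.sum_div, Finset.sum_sub_distrib, ← Finset.mul_sum]
      exact div_pos hD2 hii)
    (by
      simp only [e2, ← Finset.sum_div]
      exact div_pos hi hii)
  rw [e1] at hj
  rw [e2] at hl
  exact ⟨i, j, l, hii, (div_pos_iff_of_pos_right hii).1 hj, (div_pos_iff_of_pos_right hii).1 hl⟩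

theorem quadForm_two_nonneg {a b d x y : ℝ} (ha : 0 < a) (hd : 0 < a * d - b ^ 2) :
    0 ≤ a * x ^ 2 + d * y ^ 2 + 2 * b * x * y := by
  have e : a * x ^ 2 + d * y ^ 2 + 2 * b * x * y =
      ((a * x + b * y) ^ 2 + (a * d - b ^ 2) * y ^ 2) / a := by field_simp; ring
  rw [e]; positivity

theorem quadForm_three_nonneg {ι : Type*} (C : ι → ι → ℝ) {i j l : ι} (h1 : 0 < C i i)
    (h2 : 0 < C i i * C j j - C i j ^ 2) (h3 : 0 < symMinor C i j l) (x y z : ℝ) :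
    0 ≤ C i i * x ^ 2 + C j j * y ^ 2 + C l l * z ^ 2 + 2 * C i j * x * y + 2 * C i l * x * z +
      2 * C j l * y * z := by
  -- Desnanot–Jacobi: the left side of the inequality's nonzero part is `C i i` times the 3 × 3
  -- minor.
  have h3' : 0 < (C i i * C j j - C i j ^ 2) * (C i i * C l l - C i l ^ 2) -
      (C i i * C j l - C i j * C i l) ^ 2 := by
    have := mul_pos h1 h3
    unfold symMinor at this
    nlinarith
  have k := quadForm_two_nonneg (x := y) (y := z) h2 h3'
  have e : C i i * x ^ 2 + C j j * y ^ 2 + C l l * z ^ 2 + 2 * C i j * x * y + 2 * C i l * x * z +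
      2 * C j l * y * z = ((C i i * x + C i j * y + C i l * z) ^ 2 +
      ((C i i * C j j - C i j ^ 2) * y ^ 2 + (C i i * C l l - C i l ^ 2) * z ^ 2 +
        2 * (C i i * C j l - C i j * C i l) * y * z)) / C i i := by
    field_simp; ring
  rw [e]
  positivity

/-! ### Power traces of a shifted projection. -/

section Projection

variable {ι : Type*} [Fintype ι]

theorem sum_sq_eq_trace_of_isSymm (C : Matrix ι ι ℝ) (hC : C.IsSymm) :
    ∑ i, ∑ j, C i j ^ 2 = (C * C).trace := by
  simp only [Matrix.trace, Matrix.diag, Matrix.mul_apply]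
  refine Finset.sum_congr rfl fun i _ => Finset.sum_congr rfl fun j _ => ?_
  rw [hC.apply i j, sq]

theorem sum_cube_eq_trace_of_isSymm (C : Matrix ι ι ℝ) (hC : C.IsSymm) :
    ∑ i, ∑ j, ∑ l, C i j * C i l * C j l = (C * C * C).trace := by
  simp only [Matrix.trace, Matrix.diag, Matrix.mul_apply, Finset.sum_mul]
  refine Finset.sum_congr rfl fun i _ => ?_
  rw [Finset.sum_comm]
  refine Finset.sum_congr rfl fun l _ => Finset.sum_congr rfl fun j _ => ?_
  rw [← hC.apply l i]
  ring

variable [DecidableEq ι] {P : Matrix ι ι ℝ} {n : ℝ} (y : ℝ)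

theorem trace_sub_smul_one (htr : P.trace = n) :
    (P - y • (1 : Matrix ι ι ℝ)).trace = n - Fintype.card ι * y := by
  rw [Matrix.trace_sub, Matrix.trace_smul, Matrix.trace_one, htr, smul_eq_mul, mul_comm]

theorem trace_sub_smul_one_sq (hP : P * P = P) (htr : P.trace = n) :
    ((P - y • (1 : Matrix ι ι ℝ)) * (P - y • (1 : Matrix ι ι ℝ))).trace =
      (1 - 2 * y) * n + Fintype.card ι * y ^ 2 := by
  have : (P - y • (1 : Matrix ι ι ℝ)) * (P - y • (1 : Matrix ι ι ℝ)) =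
      (1 - 2 * y) • P + y ^ 2 • (1 : Matrix ι ι ℝ) := by
    simp only [sub_mul, mul_sub, Matrix.smul_mul, Matrix.mul_smul, one_mul, mul_one, hP]
    module
  rw [this, Matrix.trace_add, Matrix.trace_smul, Matrix.trace_smul, Matrix.trace_one, htr,
    smul_eq_mul, smul_eq_mul, mul_comm (y ^ 2)]

theorem trace_sub_smul_one_cube (hP : P * P = P) (htr : P.trace = n) :
    ((P - y • (1 : Matrix ι ι ℝ)) * (P - y • (1 : Matrix ι ι ℝ)) *
      (P - y • (1 : Matrix ι ι ℝ))).trace =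
      (1 - 3 * y + 3 * y ^ 2) * n - Fintype.card ι * y ^ 3 := by
  have : (P - y • (1 : Matrix ι ι ℝ)) * (P - y • (1 : Matrix ι ι ℝ)) *
      (P - y • (1 : Matrix ι ι ℝ)) =
      (1 - 3 * y + 3 * y ^ 2) • P + (-y ^ 3) • (1 : Matrix ι ι ℝ) := by
    simp only [sub_mul, mul_sub, Matrix.smul_mul, Matrix.mul_smul, one_mul, mul_one, hP]
    module
  rw [this, Matrix.trace_add, Matrix.trace_smul, Matrix.trace_smul, Matrix.trace_one, htr,
    smul_eq_mul, smul_eq_mul]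
  ring

/-- Newton's identity p₁² - p₂ = 2e₂; idempotence of `P` makes the power traces explicit. -/
theorem sum_minor_two (hP : P * P = P) (hs : P.IsSymm) (htr : P.trace = n) :
    ∑ i, ∑ j, ((P - y • (1 : Matrix ι ι ℝ)) i i * (P - y • (1 : Matrix ι ι ℝ)) j j -
      (P - y • (1 : Matrix ι ι ℝ)) i j ^ 2) =
      (n - Fintype.card ι * y) ^ 2 - ((1 - 2 * y) * n + Fintype.card ι * y ^ 2) := by
  have hC : (P - y • (1 : Matrix ι ι ℝ)).IsSymm := hs.sub (Matrix.isSymm_one.smul y)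
  rw [← trace_sub_smul_one y htr, ← trace_sub_smul_one_sq y hP htr,
    ← sum_sq_eq_trace_of_isSymm _ hC, sq]
  simp only [Finset.sum_sub_distrib, ← Finset.mul_sum, ← Finset.sum_mul]
  rfl

/-- Newton's identity p₁³ - 3p₁p₂ + 2p₃ = 6e₃. -/
theorem sum_minor_three (hP : P * P = P) (hs : P.IsSymm) (htr : P.trace = n) :
    ∑ i, ∑ j, ∑ l, symMinor (P - y • (1 : Matrix ι ι ℝ)) i j l =
      (n - Fintype.card ι * y) ^ 3 -
      3 * (n - Fintype.card ι * y) * ((1 - 2 * y) * n + Fintype.card ι * y ^ 2) +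
      2 * ((1 - 3 * y + 3 * y ^ 2) * n - Fintype.card ι * y ^ 3) := by
  have hC : (P - y • (1 : Matrix ι ι ℝ)).IsSymm := hs.sub (Matrix.isSymm_one.smul y)
  rw [← trace_sub_smul_one y htr, ← trace_sub_smul_one_sq y hP htr,
    ← trace_sub_smul_one_cube y hP htr,
    ← sum_sq_eq_trace_of_isSymm _ hC, ← sum_cube_eq_trace_of_isSymm _ hC]
  have e := Finset.sum_congr (rfl : (Finset.univ : Finset ι) = Finset.univ) fun i _ =>
    sum_sum_symMinor (P - y • (1 : Matrix ι ι ℝ)) i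
  rw [e]
  simp only [Finset.sum_add_distrib, Finset.sum_sub_distrib, ← Finset.mul_sum,
    ← Finset.sum_mul, Matrix.trace, Matrix.diag]
  ring

end Projection

/-! ### Selecting two or three columns. -/

section Columns

variable {n m : ℕ} {U : Matrix (Fin n) (Fin m) ℝ}

theorem gram_mul_self (hU : U * U.transpose = 1) :
    (U.transpose * U) * (U.transpose * U) = U.transpose * U := by
  rw [Matrix.mul_assoc, ← Matrix.mul_assoc U, hU, Matrix.one_mul]

theorem trace_gram (hU : U * U.transpose = 1) : (U.transpose * U).trace = n := by
  rw [Matrix.trace_mul_comm, hU, Matrix.trace_one, Fintype.card_fin]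

theorem sum_sq_mulVec_sub (U : Matrix (Fin n) (Fin m) ℝ) (y : ℝ) (S : Finset (Fin m))
    (z : Fin m → ℝ) (hz : ∀ j ∉ S, z j = 0) :
    ∑ i, (U.mulVec z i) ^ 2 - y * ∑ j, z j ^ 2 =
      ∑ a ∈ S, ∑ b ∈ S, z a * z b * (U.transpose * U - y • (1 : Matrix (Fin m) (Fin m) ℝ)) a b := by
  have h1 : ∑ i, (U.mulVec z i) ^ 2 = z ⬝ᵥ (U.transpose * U).mulVec z := by
    rw [← Matrix.mulVec_mulVec, Matrix.dotProduct_mulVec, Matrix.vecMul_transpose]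
    simp only [dotProduct, sq]
  have h2 : ∑ j, z j ^ 2 = z ⬝ᵥ z := by simp only [dotProduct, sq]
  have h3 : ∑ i, (U.mulVec z i) ^ 2 - y * ∑ j, z j ^ 2 =
      z ⬝ᵥ (U.transpose * U - y • (1 : Matrix (Fin m) (Fin m) ℝ)).mulVec z := by
    rw [Matrix.sub_mulVec, Matrix.smul_mulVec, Matrix.one_mulVec, dotProduct_sub, dotProduct_smul,
      h1, h2, smul_eq_mul]
  rw [h3]
  simp only [dotProduct, Matrix.mulVec, Finset.mul_sum]
  rw [← Finset.sum_subset (Finset.subset_univ S)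
    (fun a _ ha => by simp [hz a ha])]
  refine Finset.sum_congr rfl fun a _ => ?_
  rw [← Finset.sum_subset (Finset.subset_univ S) (fun b _ hb => by simp [hz b hb])]
  exact Finset.sum_congr rfl fun b _ => by ring

/-- The smallest eigenvalue of a suitable `2 × 2` principal submatrix of `Uᵀ U` is at least the
smallest root of the expected characteristic polynomial. -/
theorem exists_two_columns (hn : 2 ≤ n) (hnm : n ≤ m)
    (hU : U * U.transpose = 1) {y : ℝ} (hy : y < g1 m n) :
    ∃ S : Finset (Fin m), S.card = 2 ∧ ∀ z : Fin m → ℝ, (∀ j ∉ S, z j = 0) →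
      y * ∑ j, z j ^ 2 ≤ ∑ i, (U.mulVec z i) ^ 2 := by
  have hm' : (2 : ℝ) ≤ m := by exact_mod_cast hn.trans hnm
  have hm0 : (0 : ℝ) < m := by linarith
  have hm1 : (0 : ℝ) < m - 1 := by linarith
  obtain ⟨h1, h2⟩ := quadraticGT_of_lt_g1 (hn.trans hnm) (Nat.cast_nonneg n)
    (by exact_mod_cast hnm) hy
  have hP := gram_mul_self hU
  have hs : (U.transpose * U).IsSymm := by
    rw [Matrix.IsSymm, Matrix.transpose_mul, Matrix.transpose_transpose]
  have htr := trace_gram hU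
  have t1 := trace_sub_smul_one y htr
  have t2 := sum_minor_two y hP hs htr
  have sym : (U.transpose * U - y • (1 : Matrix (Fin m) (Fin m) ℝ)).IsSymm := hs.sub (Matrix.isSymm_one.smul y)
  have supp := sum_sq_mulVec_sub U y
  rw [Fintype.card_fin] at t1 t2
  set C := U.transpose * U - y • (1 : Matrix (Fin m) (Fin m) ℝ) with hC
  obtain ⟨i, j, hi, hij⟩ := exists_pos_minor_two C
    (by
      change 0 < C.trace
      rw [t1]
      have : (n : ℝ) - m * y = m / 2 * (2 * (n / m) - 2 * y) := by field_simp
      rw [this]; positivity)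
    (by
      rw [t2]
      have : ((n : ℝ) - m * y) ^ 2 - ((1 - 2 * y) * n + m * y ^ 2) =
        m * (m - 1) * (n * (n - 1) / (m * (m - 1)) - y * (2 * (n / m)) + y ^ 2) := by
        field_simp; ring
      rw [this]; positivity)
  -- The sums run over all index pairs, but a repeated index gives a zero minor.
  have hne : i ≠ j := by
    rintro rfl
    apply hij.ne'; ring
  refine ⟨{i, j}, Finset.card_pair hne, fun z hz => ?_⟩
  rw [← sub_nonneg, supp _ z hz, Finset.sum_pair hne, Finset.sum_pair hne, Finset.sum_pair hne]
  have := quadForm_two_nonneg (x := z i) (y := z j) hi hij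
  rw [sym.apply i j]
  linarith

/-- The smallest eigenvalue of a suitable `3 × 3` principal submatrix of `Uᵀ U` is at least the
smallest root of the expected characteristic polynomial. -/
theorem exists_three_columns (hn : 3 ≤ n) (hnm : n ≤ m)
    (hU : U * U.transpose = 1) {y : ℝ} (hy : y < g2 m n) :
    ∃ S : Finset (Fin m), S.card = 3 ∧ ∀ z : Fin m → ℝ, (∀ j ∉ S, z j = 0) →
      y * ∑ j, z j ^ 2 ≤ ∑ i, (U.mulVec z i) ^ 2 := by
  have hm' : (3 : ℝ) ≤ m := by exact_mod_cast hn.trans hnm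
  have hm0 : (0 : ℝ) < m := by linarith
  have hm1 : (0 : ℝ) < m - 1 := by linarith
  have hm2 : (0 : ℝ) < m - 2 := by linarith
  have hnm' : (n : ℝ) ≤ m - 1 ∨ (n : ℝ) = m := by
    rcases hnm.lt_or_eq with h | h
    · left
      have : (n : ℝ) + 1 ≤ m := by exact_mod_cast h
      linarith
    · right; rw [h]
  obtain ⟨h1, h2, h3⟩ := cubicGT_of_lt_g2 (hn.trans hnm)
    (by exact_mod_cast le_trans (by norm_num) hn) hnm' hy
  have hP := gram_mul_self hU
  have hs : (U.transpose * U).IsSymm := by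
    rw [Matrix.IsSymm, Matrix.transpose_mul, Matrix.transpose_transpose]
  have htr := trace_gram hU
  have t1 := trace_sub_smul_one y htr
  have t2 := sum_minor_two y hP hs htr
  have t3 := sum_minor_three y hP hs htr
  have sym : (U.transpose * U - y • (1 : Matrix (Fin m) (Fin m) ℝ)).IsSymm := hs.sub (Matrix.isSymm_one.smul y)
  have supp := sum_sq_mulVec_sub U y
  rw [Fintype.card_fin] at t1 t2 t3
  set C := U.transpose * U - y • (1 : Matrix (Fin m) (Fin m) ℝ) with hC
  obtain ⟨i, j, l, hi, hij, hijl⟩ := exists_pos_minor_three C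
    (by
      change 0 < C.trace
      rw [t1]
      have : (n : ℝ) - m * y = m / 3 * (3 * (n / m) - 3 * y) := by field_simp
      rw [this]; positivity)
    (by
      rw [t2]
      have : ((n : ℝ) - m * y) ^ 2 - ((1 - 2 * y) * n + m * y ^ 2) =
        m * (m - 1) / 3 * (3 * (n * (n - 1) / (m * (m - 1))) - 2 * y * (3 * (n / m)) +
          3 * y ^ 2) := by
        field_simp; ring
      rw [this]; positivity)
    (by
      rw [t3]
      have : ((n : ℝ) - m * y) ^ 3 - 3 * (n - m * y) * ((1 - 2 * y) * n + m * y ^ 2) +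
          2 * ((1 - 3 * y + 3 * y ^ 2) * n - m * y ^ 3) =
        m * (m - 1) * (m - 2) * (n * (n - 1) * (n - 2) / (m * (m - 1) * (m - 2)) -
          y * (3 * (n * (n - 1) / (m * (m - 1)))) + y ^ 2 * (3 * (n / m)) - y ^ 3) := by
        field_simp; ring
      rw [this]; positivity)
  have hne : i ≠ j := by
    rintro rfl
    apply hij.ne'; ring
  have hne2 : i ≠ l := by
    rintro rfl
    apply hijl.ne'; unfold symMinor; rw [sym.apply i j]; ring
  have hne3 : j ≠ l := by
    rintro rfl
    apply hijl.ne'; unfold symMinor; ring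
  have hi3 : i ∉ ({j, l} : Finset (Fin m)) := by simp [hne, hne2]
  refine ⟨{i, j, l}, Finset.card_eq_three.2 ⟨i, j, l, hne, hne2, hne3, rfl⟩, fun z hz => ?_⟩
  rw [← sub_nonneg, supp _ z hz]
  simp only [Finset.sum_insert hi3, Finset.sum_pair hne3]
  have := quadForm_three_nonneg C hi hij hijl (z i) (z j) (z l)
  rw [sym.apply i j, sym.apply i l, sym.apply j l]
  linarith

end Columns

/-! ### Frame operators and rank-one updates. -/

/-- The frame operator `∑ j ∈ S, u j (u j)ᵀ`. -/
def frameOp {ι κ : Type*} (u : ι → κ → ℝ) (S : Finset ι) : Matrix κ κ ℝ :=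
  ∑ j ∈ S, Matrix.vecMulVec (u j) (u j)

section FrameOp

variable {ι κ : Type*} (u : ι → κ → ℝ) (S : Finset ι)

theorem frameOp_apply (a b : κ) : frameOp u S a b = ∑ j ∈ S, u j a * u j b := by
  simp [frameOp, Matrix.sum_apply, Matrix.vecMulVec_apply]

theorem frameOp_isSymm : (frameOp u S).IsSymm := by
  ext a b
  simp only [Matrix.transpose_apply, frameOp_apply, mul_comm]

theorem frameOp_erase [DecidableEq ι] {j : ι} (hj : j ∈ S) :
    frameOp u (S.erase j) = frameOp u S - Matrix.vecMulVec (u j) (u j) := by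
  rw [frameOp, frameOp, ← Finset.sum_erase_add S _ hj, add_sub_cancel_right]

theorem frameOp_posSemidef [Fintype κ] : (frameOp u S).PosSemidef := by
  refine Matrix.posSemidef_sum S fun j _ => ?_
  simpa using Matrix.posSemidef_vecMulVec_self_star (u j)

theorem dotProduct_frameOp [Fintype κ] (z : κ → ℝ) :
    z ⬝ᵥ (frameOp u S).mulVec z = ∑ j ∈ S, (u j ⬝ᵥ z) ^ 2 := by
  rw [frameOp, Matrix.sum_mulVec, dotProduct_sum]
  refine Finset.sum_congr rfl fun j _ => ?_
  rw [Matrix.vecMulVec_mulVec, dotProduct_smul, dotProduct_comm z, sq]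
  simp

/-- A convex combination of the frame operators of `S` and `S.erase j`; it supplies the
real-rootedness needed in `of_segment`. -/
theorem frameOp_sub_smul_posSemidef [Fintype κ] [DecidableEq ι] {j : ι} (hj : j ∈ S) {t : ℝ}
    (ht0 : 0 ≤ t) (ht : t ≤ 1) :
    (frameOp u S - t • Matrix.vecMulVec (u j) (u j)).PosSemidef := by
  have e : frameOp u S - t • Matrix.vecMulVec (u j) (u j) =
      (1 - t) • frameOp u S + t • frameOp u (S.erase j) := by
    rw [frameOp_erase u S hj]; module
  rw [e]
  exact ((frameOp_posSemidef u S).smul (sub_nonneg.2 ht)).add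
    ((frameOp_posSemidef u _).smul ht0)

end FrameOp

/-! ### Invariants of 3 × 3 matrices. -/

/-- Sum of the principal `2 × 2` minors of a `3 × 3` matrix. -/
def secondInvariant (M : Matrix (Fin 3) (Fin 3) ℝ) : ℝ :=
  M 0 0 * M 1 1 - M 0 1 * M 1 0 + (M 0 0 * M 2 2 - M 0 2 * M 2 0) +
    (M 1 1 * M 2 2 - M 1 2 * M 2 1)

section Three

variable (M : Matrix (Fin 3) (Fin 3) ℝ)

/-- The update has rank one, so no higher power of `t` occurs. -/
theorem det_sub_smul_vecMulVec (v : Fin 3 → ℝ) (t : ℝ) :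
    (M - t • Matrix.vecMulVec v v).det =
      (1 - t) * M.det + t * (M - Matrix.vecMulVec v v).det := by
  simp only [Matrix.det_fin_three, Matrix.sub_apply, Matrix.smul_apply, Matrix.vecMulVec_apply,
    smul_eq_mul]
  ring

theorem secondInvariant_sub_smul_vecMulVec (v : Fin 3 → ℝ) (t : ℝ) :
    secondInvariant (M - t • Matrix.vecMulVec v v) =
      (1 - t) * secondInvariant M + t * secondInvariant (M - Matrix.vecMulVec v v) := by
  simp only [secondInvariant, Matrix.sub_apply, Matrix.smul_apply, Matrix.vecMulVec_apply,
    smul_eq_mul]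
  ring

theorem trace_sub_smul_vecMulVec {κ : Type*} [Fintype κ] (M : Matrix κ κ ℝ) (v : κ → ℝ) (t : ℝ) :
    (M - t • Matrix.vecMulVec v v).trace =
      (1 - t) * M.trace + t * (M - Matrix.vecMulVec v v).trace := by
  simp only [Matrix.trace_sub, Matrix.trace_smul, smul_eq_mul]
  ring

variable {M}

theorem trace_eq_eigenvalues_three (hM : M.IsHermitian) :
    M.trace = hM.eigenvalues 0 + hM.eigenvalues 1 + hM.eigenvalues 2 := by
  simp [hM.trace_eq_sum_eigenvalues, Fin.sum_univ_three]

theorem det_eq_eigenvalues_three (hM : M.IsHermitian) :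
    M.det = hM.eigenvalues 0 * hM.eigenvalues 1 * hM.eigenvalues 2 := by
  simp [hM.det_eq_prod_eigenvalues, Fin.prod_univ_three]

theorem secondInvariant_eq_eigenvalues (hM : M.IsHermitian) :
    secondInvariant M = hM.eigenvalues 0 * hM.eigenvalues 1 +
      hM.eigenvalues 0 * hM.eigenvalues 2 + hM.eigenvalues 1 * hM.eigenvalues 2 := by
  -- One value of the characteristic polynomial suffices, since trace and determinant are already
  -- known.
  have h := congrArg (Polynomial.eval 1) hM.charpoly_eq
  rw [Matrix.eval_charpoly] at h
  simp only [Fin.prod_univ_three, Polynomial.eval_mul, Polynomial.eval_sub, Polynomial.eval_X,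
    Polynomial.eval_C, RCLike.ofReal_real_eq_id, id_eq] at h
  have h1 := trace_eq_eigenvalues_three hM
  have h3 := det_eq_eigenvalues_three hM
  rw [Matrix.det_fin_three] at h h3
  rw [Matrix.trace_fin_three] at h1
  simp [Matrix.scalar_apply] at h
  unfold secondInvariant
  linear_combination h + h1 + h3

theorem cubicNonnegRoots_of_posSemidef (hM : M.PosSemidef) :
    CubicNonnegRoots M.trace (secondInvariant M) M.det := by
  rw [trace_eq_eigenvalues_three hM.1, secondInvariant_eq_eigenvalues hM.1,
    det_eq_eigenvalues_three hM.1]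
  exact .of_roots (hM.eigenvalues_nonneg 0) (hM.eigenvalues_nonneg 1) (hM.eigenvalues_nonneg 2)

theorem posDef_sub_of_cubicGT (hM : M.IsSymm) {y : ℝ}
    (h : CubicGT y M.trace (secondInvariant M) M.det) :
    (M - y • (1 : Matrix (Fin 3) (Fin 3) ℝ)).PosDef := by
  have hN : (M - y • (1 : Matrix (Fin 3) (Fin 3) ℝ)).IsHermitian :=
    (Matrix.isHermitian_iff_isSymm.2 (hM.sub (Matrix.isSymm_one.smul y)))
  have e1 : (M - y • (1 : Matrix (Fin 3) (Fin 3) ℝ)).trace = M.trace - 3 * y := by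
    simp [Matrix.trace_fin_three]; ring
  have e2 : secondInvariant (M - y • (1 : Matrix (Fin 3) (Fin 3) ℝ)) =
      secondInvariant M - 2 * y * M.trace + 3 * y ^ 2 := by
    simp [secondInvariant, Matrix.trace_fin_three]; ring
  have e3 : (M - y • (1 : Matrix (Fin 3) (Fin 3) ℝ)).det =
      M.det - y * secondInvariant M + y ^ 2 * M.trace - y ^ 3 := by
    simp [secondInvariant, Matrix.trace_fin_three, Matrix.det_fin_three]; ring
  rw [hN.posDef_iff_eigenvalues_pos]
  obtain ⟨h1, h2, h3⟩ := h
  rw [← e1, trace_eq_eigenvalues_three hN] at h1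
  rw [← e2, secondInvariant_eq_eigenvalues hN] at h2
  rw [← e3, det_eq_eigenvalues_three hN] at h3
  have key : ∀ d : ℝ, (d - hN.eigenvalues 0) * (d - hN.eigenvalues 1) *
      (d - hN.eigenvalues 2) = 0 → 0 < d := by
    intro d hd
    by_contra! hle
    have k1 := mul_nonneg h2.le (neg_nonneg.2 hle)
    have k2 := mul_nonneg h1.le (sq_nonneg d)
    have k3 := pow_nonneg (neg_nonneg.2 hle) 3
    nlinarith
  intro i
  apply key
  fin_cases i <;> simp

variable {ι : Type*} (u : ι → Fin 3 → ℝ) (S : Finset ι)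

/-- By Cauchy–Binet the r-th invariant is a sum over r-subsets of `S`, each of which survives |S| -
r deletions. This explains the factors here (r = 1) and for `secondInvariant` and `det`. -/
theorem sum_trace_erase {κ : Type*} [Fintype κ] [DecidableEq ι] (u : ι → κ → ℝ) :
    ∑ j ∈ S, (frameOp u (S.erase j)).trace = (S.card - 1) * (frameOp u S).trace := by
  have e : ∀ j ∈ S, (frameOp u (S.erase j)).trace =
      (frameOp u S).trace - ∑ a, u j a * u j a := by
    intro j hj
    rw [frameOp_erase u S hj, Matrix.trace_sub]
    rfl
  rw [Finset.sum_congr rfl e, Finset.sum_sub_distrib, Finset.sum_comm]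
  simp only [← frameOp_apply, Finset.sum_const, nsmul_eq_mul]
  change _ - (frameOp u S).trace = _
  ring

theorem sum_secondInvariant_erase [DecidableEq ι] :
    ∑ j ∈ S, secondInvariant (frameOp u (S.erase j)) =
      (S.card - 2) * secondInvariant (frameOp u S) := by
  have hM := frameOp_apply u S
  have e : ∀ j ∈ S, secondInvariant (frameOp u (S.erase j)) = secondInvariant (frameOp u S) -
      (frameOp u S 1 1 + frameOp u S 2 2) * (u j 0 * u j 0) -
      (frameOp u S 0 0 + frameOp u S 2 2) * (u j 1 * u j 1) -
      (frameOp u S 0 0 + frameOp u S 1 1) * (u j 2 * u j 2) +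
      (frameOp u S 1 0 + frameOp u S 0 1) * (u j 0 * u j 1) +
      (frameOp u S 2 0 + frameOp u S 0 2) * (u j 0 * u j 2) +
      (frameOp u S 2 1 + frameOp u S 1 2) * (u j 1 * u j 2) := by
    intro j hj
    rw [frameOp_erase u S hj]
    simp only [secondInvariant, Matrix.sub_apply, Matrix.vecMulVec_apply]
    ring
  rw [Finset.sum_congr rfl e]
  simp only [Finset.sum_sub_distrib, Finset.sum_add_distrib, ← Finset.mul_sum, ← hM,
    Finset.sum_const, nsmul_eq_mul]
  rw [(frameOp_isSymm u S).apply 0 1, (frameOp_isSymm u S).apply 0 2,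
    (frameOp_isSymm u S).apply 1 2]
  unfold secondInvariant
  rw [(frameOp_isSymm u S).apply 0 1, (frameOp_isSymm u S).apply 0 2,
    (frameOp_isSymm u S).apply 1 2]
  ring

theorem sum_det_erase [DecidableEq ι] :
    ∑ j ∈ S, (frameOp u (S.erase j)).det = (S.card - 3) * (frameOp u S).det := by
  have hM := frameOp_apply u S
  have s1 := (frameOp_isSymm u S).apply 0 1
  have s2 := (frameOp_isSymm u S).apply 0 2
  have s3 := (frameOp_isSymm u S).apply 1 2
  have e : ∀ j ∈ S, (frameOp u (S.erase j)).det = (frameOp u S).det -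
      (frameOp u S 1 1 * frameOp u S 2 2 - frameOp u S 1 2 ^ 2) * (u j 0 * u j 0) -
      (frameOp u S 0 0 * frameOp u S 2 2 - frameOp u S 0 2 ^ 2) * (u j 1 * u j 1) -
      (frameOp u S 0 0 * frameOp u S 1 1 - frameOp u S 0 1 ^ 2) * (u j 2 * u j 2) +
      2 * (frameOp u S 0 1 * frameOp u S 2 2 - frameOp u S 0 2 * frameOp u S 1 2) *
        (u j 0 * u j 1) +
      2 * (frameOp u S 0 2 * frameOp u S 1 1 - frameOp u S 0 1 * frameOp u S 1 2) *
        (u j 0 * u j 2) +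
      2 * (frameOp u S 1 2 * frameOp u S 0 0 - frameOp u S 0 1 * frameOp u S 0 2) *
        (u j 1 * u j 2) := by
    intro j hj
    rw [frameOp_erase u S hj]
    simp only [Matrix.det_fin_three, Matrix.sub_apply, Matrix.vecMulVec_apply, s1, s2, s3]
    ring
  rw [Finset.sum_congr rfl e]
  simp only [Finset.sum_sub_distrib, Finset.sum_add_distrib, ← Finset.mul_sum, ← hM,
    Finset.sum_const, nsmul_eq_mul]
  simp only [Matrix.det_fin_three, s1, s2, s3]
  ring

end Three

/-! ### Deleting vectors in dimension three. -/

/-- The polynomial obtained by averaging the characteristic polynomials of the frame operators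
of the `k`-subsets of `s` vectors with frame operator `M` has all its roots above `y`. -/
def ExpectedCubicGT (y k s : ℝ) (M : Matrix (Fin 3) (Fin 3) ℝ) : Prop :=
  CubicGT y (k / s * M.trace) (k * (k - 1) / (s * (s - 1)) * secondInvariant M)
    (k * (k - 1) * (k - 2) / (s * (s - 1) * (s - 2)) * M.det)

theorem CubicNonnegRoots.expected {a b c : ℝ} (h : CubicNonnegRoots a b c) {k : ℕ} (hk : 3 ≤ k)
    {s : ℕ} (hks : k ≤ s) :
    CubicNonnegRoots (k / s * a) (k * (k - 1) / (s * (s - 1)) * b)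
      (k * (k - 1) * (k - 2) / (s * (s - 1) * (s - 2)) * c) := by
  have hk' : (3 : ℝ) ≤ k := by exact_mod_cast hk
  induction s, hks using Nat.le_induction with
  | base =>
    have h1 : (k : ℝ) - 1 ≠ 0 := by linarith
    have h2 : (k : ℝ) - 2 ≠ 0 := by linarith
    have h0 : (k : ℝ) ≠ 0 := by linarith
    rw [div_self h0, div_self (mul_ne_zero h0 h1), div_self (mul_ne_zero (mul_ne_zero h0 h1) h2)]
    simpa using h
  | succ s hs ih =>
    -- Going from `s` to `s + 1` multiplies the r-th coefficient by (s+1-r)/(s+1).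
    have := ih.polar (s - 2) (by omega)
    have hs' : (3 : ℝ) ≤ s := by exact_mod_cast hk.trans hs
    have h1 : (s : ℝ) - 1 ≠ 0 := by linarith
    have h2 : (s : ℝ) - 2 ≠ 0 := by linarith
    rw [Nat.cast_sub (by omega)] at this
    push_cast at this ⊢
    have h3 : (s : ℝ) - 2 + 3 ≠ 0 := by linarith
    convert this using 1
    · field_simp; ring
    · rw [show (s : ℝ) - 2 + 3 = s + 1 by ring, show (s : ℝ) - 2 + 1 = s - 1 by ring]
      rw [show (s : ℝ) + 1 - 1 = s by ring]
      field_simp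
    · rw [show (s : ℝ) - 2 + 3 = s + 1 by ring]
      rw [show (s : ℝ) + 1 - 1 = s by ring, show (s : ℝ) + 1 - 2 = s - 1 by ring]
      field_simp

/-- The polynomial of `S` is the mean of those of `S.erase j`, so some `j` keeps the last shifted
coefficient positive. `of_polar` gives the full condition for the undiminished operator with `s` in
place of `s + 1`, and `of_segment` carries it to `S.erase j`. -/
theorem exists_erase_expectedCubicGT {ι : Type*} [DecidableEq ι] (u : ι → Fin 3 → ℝ) {y : ℝ}
    {k s : ℕ} (hk : 3 ≤ k) (hks : k ≤ s) {S : Finset ι} (hS : S.card = s + 1)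
    (h : ExpectedCubicGT y k (s + 1) (frameOp u S)) :
    ∃ j ∈ S, ExpectedCubicGT y k s (frameOp u (S.erase j)) := by
  have hs' : (3 : ℝ) ≤ s := by exact_mod_cast hk.trans hks
  have h0 : 0 < (s : ℝ) := by linarith
  have h1 : 0 < (s : ℝ) - 1 := by linarith
  have h2 : 0 < (s : ℝ) - 2 := by linarith
  set α : ℝ := k / s with hα
  set β : ℝ := k * (k - 1) / (s * (s - 1)) with hβ
  set γ : ℝ := k * (k - 1) * (k - 2) / (s * (s - 1) * (s - 2)) with hγ
  have hα' : (k : ℝ) / (s + 1) = s / (s + 1) * α := by rw [hα]; field_simp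
  have hβ' : (k : ℝ) * (k - 1) / ((s + 1) * (s + 1 - 1)) = (s - 1) / (s + 1) * β := by
    rw [hβ, add_sub_cancel_right]; field_simp
  have hγ' : (k : ℝ) * (k - 1) * (k - 2) / ((s + 1) * (s + 1 - 1) * (s + 1 - 2)) =
      (s - 2) / (s + 1) * γ := by
    rw [hγ, add_sub_cancel_right, show (s : ℝ) + 1 - 2 = s - 1 by ring]; field_simp
  rw [ExpectedCubicGT, hα', hβ', hγ', mul_assoc, mul_assoc, mul_assoc] at h
  have hsum : ∑ j ∈ S, (γ * (frameOp u (S.erase j)).det -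
      y * (β * secondInvariant (frameOp u (S.erase j))) +
      y ^ 2 * (α * (frameOp u (S.erase j)).trace) - y ^ 3) =
      (s + 1) * ((s - 2) / (s + 1) * (γ * (frameOp u S).det) -
      y * ((s - 1) / (s + 1) * (β * secondInvariant (frameOp u S))) +
      y ^ 2 * (s / (s + 1) * (α * (frameOp u S).trace)) - y ^ 3) := by
    simp only [Finset.sum_sub_distrib, Finset.sum_add_distrib, ← Finset.mul_sum, sum_det_erase,
      sum_secondInvariant_erase, sum_trace_erase, Finset.sum_const, nsmul_eq_mul, hS]
    push_cast
    field_simp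
    ring
  have hsumpos := mul_pos (by positivity : (0 : ℝ) < s + 1) h.2.2
  rw [← hsum] at hsumpos
  obtain ⟨j, hj, hpos⟩ := exists_pos_of_sum_pos hsumpos
  refine ⟨j, hj, ?_⟩
  have hroots := (cubicNonnegRoots_of_posSemidef (frameOp_posSemidef u S)).expected hk hks
  have hgt : CubicGT y (α * (frameOp u S).trace) (β * secondInvariant (frameOp u S))
      (γ * (frameOp u S).det) := by
    refine CubicGT.of_polar (s := (s : ℝ) - 2) h2 hroots ?_
    rw [show (s : ℝ) - 2 + 2 = s by ring, show (s : ℝ) - 2 + 3 = s + 1 by ring,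
      show (s : ℝ) - 2 + 1 = s - 1 by ring]
    exact h
  refine hgt.of_segment (fun t ht0 ht1 => ?_) hpos
  have := (cubicNonnegRoots_of_posSemidef
    (frameOp_sub_smul_posSemidef u S hj ht0 ht1)).expected hk hks
  rw [trace_sub_smul_vecMulVec, secondInvariant_sub_smul_vecMulVec, det_sub_smul_vecMulVec,
    ← frameOp_erase u S hj] at this
  convert this using 1 <;> ring

theorem exists_subset_cubicGT {ι : Type*} [DecidableEq ι] (u : ι → Fin 3 → ℝ) {y : ℝ}
    {k s : ℕ} (hk : 3 ≤ k) (hks : k ≤ s) {S : Finset ι} (hS : S.card = s)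
    (h : ExpectedCubicGT y k s (frameOp u S)) :
    ∃ T : Finset ι, T.card = k ∧ CubicGT y (frameOp u T).trace (secondInvariant (frameOp u T))
      (frameOp u T).det := by
  induction s, hks using Nat.le_induction generalizing S with
  | base =>
    refine ⟨S, hS, ?_⟩
    have hk' : (3 : ℝ) ≤ k := by exact_mod_cast hk
    have h1 : (k : ℝ) - 1 ≠ 0 := by linarith
    have h2 : (k : ℝ) - 2 ≠ 0 := by linarith
    have h0 : (k : ℝ) ≠ 0 := by linarith
    rw [ExpectedCubicGT, div_self h0, div_self (mul_ne_zero h0 h1),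
      div_self (mul_ne_zero (mul_ne_zero h0 h1) h2), one_mul, one_mul, one_mul] at h
    exact h
  | succ s hs ih =>
    push_cast at h
    obtain ⟨j, hj, h'⟩ := exists_erase_expectedCubicGT u hk hs hS h
    exact ih (by rw [Finset.card_erase_of_mem hj, hS]; rfl) h'

/-! ### Deleting vectors in dimension two. -/

section Two

variable {M : Matrix (Fin 2) (Fin 2) ℝ}

theorem trace_eq_eigenvalues_two (hM : M.IsHermitian) :
    M.trace = hM.eigenvalues 0 + hM.eigenvalues 1 := by
  simp [hM.trace_eq_sum_eigenvalues, Fin.sum_univ_two]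

theorem det_eq_eigenvalues_two (hM : M.IsHermitian) :
    M.det = hM.eigenvalues 0 * hM.eigenvalues 1 := by
  simp [hM.det_eq_prod_eigenvalues, Fin.prod_univ_two]

theorem det_sub_smul_vecMulVec_two (M : Matrix (Fin 2) (Fin 2) ℝ) (v : Fin 2 → ℝ) (t : ℝ) :
    (M - t • Matrix.vecMulVec v v).det =
      (1 - t) * M.det + t * (M - Matrix.vecMulVec v v).det := by
  simp only [Matrix.det_fin_two, Matrix.sub_apply, Matrix.smul_apply, Matrix.vecMulVec_apply,
    smul_eq_mul]
  ring

theorem quadraticNonnegRoots_of_posSemidef (hM : M.PosSemidef) :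
    QuadraticNonnegRoots M.trace M.det := by
  rw [trace_eq_eigenvalues_two hM.1, det_eq_eigenvalues_two hM.1]
  have h0 := hM.eigenvalues_nonneg 0
  have h1 := hM.eigenvalues_nonneg 1
  refine ⟨add_nonneg h0 h1, mul_nonneg h0 h1, ?_⟩
  nlinarith [sq_nonneg (hM.1.eigenvalues 0 - hM.1.eigenvalues 1)]

theorem posDef_sub_of_quadraticGT (hM : M.IsSymm) {y : ℝ} (h : QuadraticGT y M.trace M.det) :
    (M - y • (1 : Matrix (Fin 2) (Fin 2) ℝ)).PosDef := by
  have hN : (M - y • (1 : Matrix (Fin 2) (Fin 2) ℝ)).IsHermitian :=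
    (Matrix.isHermitian_iff_isSymm.2 (hM.sub (Matrix.isSymm_one.smul y)))
  have e1 : (M - y • (1 : Matrix (Fin 2) (Fin 2) ℝ)).trace = M.trace - 2 * y := by
    simp [Matrix.trace_fin_two]; ring
  have e2 : (M - y • (1 : Matrix (Fin 2) (Fin 2) ℝ)).det = M.det - y * M.trace + y ^ 2 := by
    simp [Matrix.trace_fin_two, Matrix.det_fin_two]; ring
  rw [hN.posDef_iff_eigenvalues_pos]
  obtain ⟨h1, h2⟩ := h
  rw [← e1, trace_eq_eigenvalues_two hN] at h1
  rw [← e2, det_eq_eigenvalues_two hN] at h2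
  have h0 : 0 < hN.eigenvalues 0 := by nlinarith
  intro i
  fin_cases i
  · exact h0
  · exact pos_of_mul_pos_right h2 h0.le

theorem sum_det_erase_two {ι : Type*} [DecidableEq ι] (u : ι → Fin 2 → ℝ) (S : Finset ι) :
    ∑ j ∈ S, (frameOp u (S.erase j)).det = (S.card - 2) * (frameOp u S).det := by
  have hM := frameOp_apply u S
  have s1 := (frameOp_isSymm u S).apply 0 1
  have e : ∀ j ∈ S, (frameOp u (S.erase j)).det = (frameOp u S).det -
      frameOp u S 1 1 * (u j 0 * u j 0) - frameOp u S 0 0 * (u j 1 * u j 1) +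
      2 * frameOp u S 0 1 * (u j 0 * u j 1) := by
    intro j hj
    rw [frameOp_erase u S hj]
    simp only [Matrix.det_fin_two, Matrix.sub_apply, Matrix.vecMulVec_apply, s1]
    ring
  rw [Finset.sum_congr rfl e]
  simp only [Finset.sum_sub_distrib, Finset.sum_add_distrib, ← Finset.mul_sum, ← hM,
    Finset.sum_const, nsmul_eq_mul]
  simp only [Matrix.det_fin_two, s1]
  ring

end Two

/-- The polynomial obtained by averaging the characteristic polynomials of the frame operators
of the `k`-subsets of `s` vectors with frame operator `M` has all its roots above `y`. -/
def ExpectedQuadraticGT (y k s : ℝ) (M : Matrix (Fin 2) (Fin 2) ℝ) : Prop :=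
  QuadraticGT y (k / s * M.trace) (k * (k - 1) / (s * (s - 1)) * M.det)

theorem QuadraticNonnegRoots.expected {a b : ℝ} (h : QuadraticNonnegRoots a b) {k : ℕ}
    (hk : 2 ≤ k) {s : ℕ} (hks : k ≤ s) :
    QuadraticNonnegRoots (k / s * a) (k * (k - 1) / (s * (s - 1)) * b) := by
  have hk' : (2 : ℝ) ≤ k := by exact_mod_cast hk
  induction s, hks using Nat.le_induction with
  | base =>
    have h1 : (k : ℝ) - 1 ≠ 0 := by linarith
    have h0 : (k : ℝ) ≠ 0 := by linarith
    rw [div_self h0, div_self (mul_ne_zero h0 h1)]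
    simpa using h
  | succ s hs ih =>
    have hs' : (2 : ℝ) ≤ s := by exact_mod_cast hk.trans hs
    have h1 : (0 : ℝ) < s - 1 := by linarith
    have := ih.polar h1
    push_cast
    convert this using 1
    · rw [show (s : ℝ) - 1 + 2 = s + 1 by ring, show (s : ℝ) - 1 + 1 = s by ring]
      field_simp
    · rw [show (s : ℝ) - 1 + 2 = s + 1 by ring, show (s : ℝ) + 1 - 1 = s by ring]
      field_simp

theorem exists_erase_expectedQuadraticGT {ι : Type*} [DecidableEq ι] (u : ι → Fin 2 → ℝ) {y : ℝ}
    {k s : ℕ} (hk : 2 ≤ k) (hks : k ≤ s) {S : Finset ι} (hS : S.card = s + 1)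
    (h : ExpectedQuadraticGT y k (s + 1) (frameOp u S)) :
    ∃ j ∈ S, ExpectedQuadraticGT y k s (frameOp u (S.erase j)) := by
  have hs' : (2 : ℝ) ≤ s := by exact_mod_cast hk.trans hks
  have h0 : 0 < (s : ℝ) := by linarith
  have h1 : 0 < (s : ℝ) - 1 := by linarith
  set α : ℝ := k / s with hα
  set β : ℝ := k * (k - 1) / (s * (s - 1)) with hβ
  have hα' : (k : ℝ) / (s + 1) = s / (s + 1) * α := by rw [hα]; field_simp
  have hβ' : (k : ℝ) * (k - 1) / ((s + 1) * (s + 1 - 1)) = (s - 1) / (s + 1) * β := by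
    rw [hβ, add_sub_cancel_right]; field_simp
  rw [ExpectedQuadraticGT, hα', hβ', mul_assoc, mul_assoc] at h
  have hsum : ∑ j ∈ S, (β * (frameOp u (S.erase j)).det -
      y * (α * (frameOp u (S.erase j)).trace) + y ^ 2) =
      (s + 1) * ((s - 1) / (s + 1) * (β * (frameOp u S).det) -
      y * (s / (s + 1) * (α * (frameOp u S).trace)) + y ^ 2) := by
    simp only [Finset.sum_sub_distrib, Finset.sum_add_distrib, ← Finset.mul_sum,
      sum_det_erase_two, sum_trace_erase, Finset.sum_const, nsmul_eq_mul, hS]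
    push_cast
    field_simp
    ring
  have hsumpos := mul_pos (by positivity : (0 : ℝ) < s + 1) h.2
  rw [← hsum] at hsumpos
  obtain ⟨j, hj, hpos⟩ := exists_pos_of_sum_pos hsumpos
  refine ⟨j, hj, ?_⟩
  have hroots := (quadraticNonnegRoots_of_posSemidef (frameOp_posSemidef u S)).expected hk hks
  have hgt : QuadraticGT y (α * (frameOp u S).trace) (β * (frameOp u S).det) := by
    refine QuadraticGT.of_polar h1 hroots ?_
    rw [show (s : ℝ) - 1 + 2 = s + 1 by ring, show (s : ℝ) - 1 + 1 = s by ring]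
    exact h
  refine hgt.of_segment (fun t ht0 ht1 => ?_) hpos
  have := (quadraticNonnegRoots_of_posSemidef
    (frameOp_sub_smul_posSemidef u S hj ht0 ht1)).expected hk hks
  rw [trace_sub_smul_vecMulVec, det_sub_smul_vecMulVec_two, ← frameOp_erase u S hj] at this
  convert this using 1 <;> ring

theorem exists_subset_quadraticGT {ι : Type*} [DecidableEq ι] (u : ι → Fin 2 → ℝ) {y : ℝ}
    {k s : ℕ} (hk : 2 ≤ k) (hks : k ≤ s) {S : Finset ι} (hS : S.card = s)
    (h : ExpectedQuadraticGT y k s (frameOp u S)) :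
    ∃ T : Finset ι, T.card = k ∧ QuadraticGT y (frameOp u T).trace (frameOp u T).det := by
  induction s, hks using Nat.le_induction generalizing S with
  | base =>
    refine ⟨S, hS, ?_⟩
    have hk' : (2 : ℝ) ≤ k := by exact_mod_cast hk
    have h1 : (k : ℝ) - 1 ≠ 0 := by linarith
    have h0 : (k : ℝ) ≠ 0 := by linarith
    rw [ExpectedQuadraticGT, div_self h0, div_self (mul_ne_zero h0 h1), one_mul, one_mul] at h
    exact h
  | succ s hs ih =>
    push_cast at h
    obtain ⟨j, hj, h'⟩ := exists_erase_expectedQuadraticGT u hk hs hS h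
    exact ih (by rw [Finset.card_erase_of_mem hj, hS]; rfl) h'

/-! ### Matrices with two or three orthonormal rows. -/

section Rows

variable {n m : ℕ} (U : Matrix (Fin n) (Fin m) ℝ)

theorem frameOp_univ_eq_one (hU : U * U.transpose = 1) :
    frameOp U.col Finset.univ = 1 := by
  rw [← hU]
  ext a b
  rw [frameOp_apply, Matrix.mul_apply]
  rfl

theorem le_sum_sq_of_posDef_sub {S : Finset (Fin m)} {y : ℝ}
    (h : (frameOp U.col S - y • (1 : Matrix (Fin n) (Fin n) ℝ)).PosDef) (z : Fin n → ℝ) :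
    y * ∑ i, z i ^ 2 ≤ ∑ j ∈ S, (U.transpose.mulVec z j) ^ 2 := by
  have := h.posSemidef.dotProduct_mulVec_nonneg z
  rw [Matrix.sub_mulVec, Matrix.smul_mulVec, Matrix.one_mulVec, dotProduct_sub, dotProduct_smul,
    star_trivial, dotProduct_frameOp, smul_eq_mul, sub_nonneg] at this
  simpa only [dotProduct, sq, Matrix.mulVec, Matrix.col, Matrix.transpose_apply] using this

/-- A suitable set of `k` columns of a matrix with two orthonormal rows attains the smallest
root of the expected characteristic polynomial. -/
theorem exists_columns_of_two_rows {U : Matrix (Fin 2) (Fin m) ℝ} (hU : U * U.transpose = 1)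
    {k : ℕ} (hk : 2 ≤ k) (hkm : k ≤ m) {y : ℝ} (hy : y < g1 m k) :
    ∃ S : Finset (Fin m), S.card = k ∧ ∀ z : Fin 2 → ℝ,
      y * ∑ i, z i ^ 2 ≤ ∑ j ∈ S, (U.transpose.mulVec z j) ^ 2 := by
  have h := quadraticGT_of_lt_g1 (hk.trans hkm) (Nat.cast_nonneg k) (by exact_mod_cast hkm) hy
  obtain ⟨T, hT, hgt⟩ := exists_subset_quadraticGT U.col hk hkm
    (S := Finset.univ) (by simp) (by
      rw [frameOp_univ_eq_one U hU, ExpectedQuadraticGT]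
      simpa [mul_comm] using h)
  exact ⟨T, hT, le_sum_sq_of_posDef_sub U (posDef_sub_of_quadraticGT (frameOp_isSymm _ _) hgt)⟩

/-- A suitable set of `k` columns of a matrix with three orthonormal rows attains the smallest
root of the expected characteristic polynomial. -/
theorem exists_columns_of_three_rows {U : Matrix (Fin 3) (Fin m) ℝ} (hU : U * U.transpose = 1)
    {k : ℕ} (hk : 3 ≤ k) (hkm : k ≤ m) {y : ℝ} (hy : y < g2 m k) :
    ∃ S : Finset (Fin m), S.card = k ∧ ∀ z : Fin 3 → ℝ,
      y * ∑ i, z i ^ 2 ≤ ∑ j ∈ S, (U.transpose.mulVec z j) ^ 2 := by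
  have hkm' : (k : ℝ) ≤ m - 1 ∨ (k : ℝ) = m := by
    rcases hkm.lt_or_eq with h | h
    · left
      have : (k : ℝ) + 1 ≤ m := by exact_mod_cast h
      linarith
    · right; rw [h]
  have h := cubicGT_of_lt_g2 (hk.trans hkm) (by exact_mod_cast le_trans (by norm_num) hk) hkm' hy
  obtain ⟨T, hT, hgt⟩ := exists_subset_cubicGT U.col hk hkm
    (S := Finset.univ) (by simp) (by
      rw [frameOp_univ_eq_one U hU, ExpectedCubicGT]
      have e : secondInvariant 1 = 3 := by
        norm_num [secondInvariant, Matrix.one_apply, show (2 : Fin 3) ≠ 0 by decide,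
          show (2 : Fin 3) ≠ 1 by decide]
      rw [e, Matrix.det_one, mul_one, Matrix.trace_one, Fintype.card_fin, mul_comm,
        mul_comm _ (3 : ℝ)]
      exact h)
  exact ⟨T, hT, le_sum_sq_of_posDef_sub U (posDef_sub_of_cubicGT (frameOp_isSymm _ _) hgt)⟩

end Rows

/-! ### Quadratic form bounds and `minNormOnSphere`. -/

section MinNorm

variable {ι κ : Type*} [Fintype ι] [Fintype κ] (M : Matrix ι κ ℝ)

theorem le_minNormOnSphere_sq [Nonempty κ] {c : ℝ}
    (h : ∀ z : κ → ℝ, c * ∑ j, z j ^ 2 ≤ ∑ i, (M.mulVec z i) ^ 2) : c ≤ minNormOnSphere M ^ 2 := by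
  obtain ⟨x, hx, hmin, -⟩ := exists_eq_minNormOnSphere M
  have hx2 : ∑ j, x.ofLp j ^ 2 = 1 := by
    rw [← EuclideanSpace.real_norm_sq_eq, hx, one_pow]
  have := h x.ofLp
  rw [hx2, mul_one] at this
  rwa [← hmin, EuclideanSpace.real_norm_sq_eq]

theorem minNormOnSphere_sq_mul_le (z : κ → ℝ) :
    minNormOnSphere M ^ 2 * ∑ j, z j ^ 2 ≤ ∑ i, (M.mulVec z i) ^ 2 := by
  by_cases hz : z = 0
  · subst hz; simp
  have hκ : Nonempty κ := by
    by_contra hne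
    rw [not_nonempty_iff] at hne
    exact hz (Subsingleton.elim _ _)
  obtain ⟨x, -, hmin, hle⟩ := exists_eq_minNormOnSphere M
  set w : EuclideanSpace ℝ κ := WithLp.toLp 2 z with hw
  have hw0 : w ≠ 0 := fun h => hz (congrArg WithLp.ofLp h)
  have hr : 0 < ‖w‖ := norm_pos_iff.2 hw0
  have h := hle (‖w‖⁻¹ • w) (by rw [norm_smul, norm_inv, norm_norm, inv_mul_cancel₀ hr.ne'])
  have e : ‖WithLp.toLp 2 (M.mulVec (‖w‖⁻¹ • w).ofLp)‖ = ‖w‖⁻¹ * ‖WithLp.toLp 2 (M.mulVec z)‖ := by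
    rw [WithLp.ofLp_smul, Matrix.mulVec_smul, WithLp.toLp_smul, norm_smul, norm_inv, norm_norm]
  rw [e, inv_mul_eq_div, le_div_iff₀ hr] at h
  have h0 : 0 ≤ minNormOnSphere M := by rw [← hmin]; exact norm_nonneg _
  have h2 := pow_le_pow_left₀ (mul_nonneg h0 hr.le) h 2
  rw [mul_pow, EuclideanSpace.real_norm_sq_eq, EuclideanSpace.real_norm_sq_eq] at h2
  exact h2

end MinNorm

/-! ### Factorization through orthonormal rows. -/

theorem sum_sq_eq_dotProduct {κ : Type*} [Fintype κ] (z : κ → ℝ) : ∑ j, z j ^ 2 = z ⬝ᵥ z := by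
  simp only [dotProduct, sq]

/-- With w = K⁻ᵀv one has |v|² = w · Kv, so |v|⁴ ≤ |w|²|Kv|² by Cauchy–Schwarz, and the hypothesis
at `w` bounds c|w|² by |v|². -/
theorem bound_of_transpose_bound {n : ℕ} {K : Matrix (Fin n) (Fin n) ℝ} (hK : IsUnit K.det) {c : ℝ}
    (h : ∀ z : Fin n → ℝ, c * ∑ i, z i ^ 2 ≤ ∑ i, (K.transpose.mulVec z i) ^ 2) (v : Fin n → ℝ) :
    c * ∑ i, v i ^ 2 ≤ ∑ i, (K.mulVec v i) ^ 2 := by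
  set w := (K.transpose)⁻¹.mulVec v with hw
  have hv : K.transpose.mulVec w = v := by
    rw [hw, Matrix.mulVec_mulVec, Matrix.mul_nonsing_inv _ (by rwa [Matrix.det_transpose]),
      Matrix.one_mulVec]
  have hcw := h w
  rw [hv] at hcw
  have hvv : ∑ i, v i ^ 2 = ∑ i, w i * K.mulVec v i := by
    change _ = w ⬝ᵥ K.mulVec v
    rw [Matrix.dotProduct_mulVec, ← Matrix.mulVec_transpose, hv, sum_sq_eq_dotProduct]
  have hcs := Finset.sum_mul_sq_le_sq_mul_sq Finset.univ w (K.mulVec v)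
  rw [← hvv] at hcs
  have hv0 : 0 ≤ ∑ i, v i ^ 2 := Finset.sum_nonneg fun i _ => sq_nonneg _
  have hk0 : 0 ≤ ∑ i, (K.mulVec v i) ^ 2 := Finset.sum_nonneg fun i _ => sq_nonneg _
  rcases hv0.eq_or_lt with h0 | h0
  · rw [← h0, mul_zero]; exact hk0
  · rcases le_or_gt c 0 with hc | hc
    · exact (mul_nonpos_of_nonpos_of_nonneg hc hv0).trans hk0
    · have h1 := mul_le_mul_of_nonneg_left hcs hc.le
      have h2 := mul_le_mul_of_nonneg_right hcw hk0
      refine le_of_mul_le_mul_right ?_ h0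
      linarith

/-- Write A Aᵀ = Bᵀ B and take K = Bᵀ, U = K⁻¹A; the rank makes `B` invertible. -/
theorem exists_eq_mul_of_rank_eq {n m : ℕ} {A : Matrix (Fin n) (Fin m) ℝ} (hA : A.rank = n) :
    ∃ (K : Matrix (Fin n) (Fin n) ℝ) (U : Matrix (Fin n) (Fin m) ℝ),
      A = K * U ∧ U * U.transpose = 1 ∧ IsUnit K.det := by
  open scoped MatrixOrder in
  have hps : (A * A.conjTranspose).PosSemidef := Matrix.posSemidef_self_mul_conjTranspose A
  obtain ⟨B, hB⟩ := CStarAlgebra.nonneg_iff_eq_star_mul_self.mp hps.nonneg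
  rw [Matrix.star_eq_conjTranspose, Matrix.conjTranspose_eq_transpose_of_trivial,
    Matrix.conjTranspose_eq_transpose_of_trivial] at hB
  have hrank : (A * A.transpose).rank = n := by rw [Matrix.rank_self_mul_transpose, hA]
  have hBr : n ≤ B.rank :=
    hrank.ge.trans (hB ▸ Matrix.rank_mul_le_right _ _)
  have hdet : IsUnit B.det := by
    rw [← Matrix.isUnit_iff_isUnit_det]
    rw [← Matrix.mulVec_surjective_iff_isUnit]
    have : LinearMap.range B.mulVecLin = ⊤ := by
      apply Submodule.eq_top_of_finrank_eq
      rw [Module.finrank_fin_fun]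
      exact le_antisymm (B.rank_le_height) hBr
    exact LinearMap.range_eq_top.1 this
  have hdetT : IsUnit B.transpose.det := by rwa [Matrix.det_transpose]
  refine ⟨B.transpose, (B.transpose)⁻¹ * A, ?_, ?_, hdetT⟩
  · rw [← Matrix.mul_assoc, Matrix.mul_nonsing_inv _ hdetT, Matrix.one_mul]
  · rw [Matrix.transpose_mul, Matrix.mul_assoc, ← Matrix.mul_assoc A, hB,
      Matrix.transpose_nonsing_inv, Matrix.transpose_transpose, Matrix.mul_assoc,
      Matrix.mul_nonsing_inv _ hdet, Matrix.mul_one, Matrix.nonsing_inv_mul _ hdetT]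

/-! ### From `A` to the factor with orthonormal rows. -/

section Reduction

variable {n m : ℕ} {A : Matrix (Fin n) (Fin m) ℝ}

theorem sigmaMin_sq_mul_le (hA : A.rank = n) (z : Fin n → ℝ) :
    sigmaMin A ^ 2 * ∑ i, z i ^ 2 ≤ ∑ j, (A.transpose.mulVec z j) ^ 2 := by
  unfold sigmaMin
  rw [Fintype.card_fin, Fintype.card_fin]
  split_ifs with h
  -- For square `A` the definition of `sigmaMin` uses `A` itself, so the bound has to be transferred
  -- to `Aᵀ`.
  · obtain rfl : m = n := le_antisymm h (hA ▸ A.rank_le_width)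
    obtain ⟨K, U, rfl, hU, hK⟩ := exists_eq_mul_of_rank_eq hA
    have hdet : IsUnit (K * U).det := by
      have := congrArg Matrix.det hU
      rw [Matrix.det_mul, Matrix.det_one] at this
      rw [Matrix.det_mul]
      exact hK.mul (IsUnit.of_mul_eq_one _ this)
    refine bound_of_transpose_bound (by rwa [Matrix.det_transpose]) (fun z => ?_) z
    rw [Matrix.transpose_transpose]
    exact minNormOnSphere_sq_mul_le _ z
  · exact minNormOnSphere_sq_mul_le _ z

theorem sum_sq_transpose_mulVec {U : Matrix (Fin n) (Fin m) ℝ} (hU : U * U.transpose = 1)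
    (z : Fin n → ℝ) : ∑ j, (U.transpose.mulVec z j) ^ 2 = ∑ i, z i ^ 2 := by
  rw [sum_sq_eq_dotProduct, sum_sq_eq_dotProduct, Matrix.dotProduct_mulVec,
    ← Matrix.mulVec_transpose, Matrix.transpose_transpose, Matrix.mulVec_mulVec, hU,
    Matrix.one_mulVec]

/-- A matrix of full row rank factors through a matrix with orthonormal rows, and the square
factor expands lengths by at least `sigmaMin A`. -/
theorem exists_factorization (hA : A.rank = n) :
    ∃ (K : Matrix (Fin n) (Fin n) ℝ) (U : Matrix (Fin n) (Fin m) ℝ),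
      A = K * U ∧ U * U.transpose = 1 ∧
      (∀ z : Fin n → ℝ, sigmaMin A ^ 2 * ∑ i, z i ^ 2 ≤ ∑ i, (K.transpose.mulVec z i) ^ 2) ∧
      ∀ z : Fin n → ℝ, sigmaMin A ^ 2 * ∑ i, z i ^ 2 ≤ ∑ i, (K.mulVec z i) ^ 2 := by
  obtain ⟨K, U, hKU, hU, hK⟩ := exists_eq_mul_of_rank_eq hA
  have h : ∀ z : Fin n → ℝ,
      sigmaMin A ^ 2 * ∑ i, z i ^ 2 ≤ ∑ i, (K.transpose.mulVec z i) ^ 2 := by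
    intro z
    have := sigmaMin_sq_mul_le hA z
    have e : A.transpose.mulVec z = U.transpose.mulVec (K.transpose.mulVec z) := by
      rw [hKU, Matrix.transpose_mul, Matrix.mulVec_mulVec]
    rwa [e, sum_sq_transpose_mulVec hU] at this
  exact ⟨K, U, hKU, hU, h, bound_of_transpose_bound hK h⟩

theorem mul_sigmaMin_sq_le_of_card_le {K : Matrix (Fin n) (Fin n) ℝ} {U : Matrix (Fin n) (Fin m) ℝ}
    (hKU : A = K * U)
    (hK : ∀ z : Fin n → ℝ, sigmaMin A ^ 2 * ∑ i, z i ^ 2 ≤ ∑ i, (K.mulVec z i) ^ 2)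
    {S : Finset (Fin m)} (hS0 : 0 < S.card) (hS : S.card ≤ n) {y : ℝ}
    (h : ∀ z : Fin m → ℝ, (∀ j ∉ S, z j = 0) → y * ∑ j, z j ^ 2 ≤ ∑ i, (U.mulVec z i) ^ 2) :
    y * sigmaMin A ^ 2 ≤ sigmaMin (colSubmatrix A S) ^ 2 := by
  have hne : Nonempty S := (Finset.card_pos.1 hS0).to_subtype
  have e : sigmaMin (colSubmatrix A S) = minNormOnSphere (colSubmatrix A S) := by
    rw [sigmaMin, if_pos (by simpa using hS)]
  rw [e]
  refine le_minNormOnSphere_sq _ fun z => ?_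
  set z' : Fin m → ℝ := fun j => if hj : j ∈ S then z ⟨j, hj⟩ else 0 with hz'
  have hout : ∀ j ∉ S, z' j = 0 := fun j hj => by simp [hz', hj]
  have hin : ∀ j : S, z' j = z j := fun j => by simp [hz']
  have hsum : ∀ f : Fin m → ℝ, (∀ j ∉ S, f j = 0) → ∑ j, f j = ∑ j : S, f j := by
    intro f hf
    rw [Finset.sum_coe_sort S f]
    exact (Finset.sum_subset (Finset.subset_univ S) fun j _ hj => hf j hj).symm
  have hzz : ∑ j, z' j ^ 2 = ∑ j, z j ^ 2 := by
    rw [hsum _ fun j hj => by simp [hout j hj]]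
    simp only [hin]
  have hAz : (colSubmatrix A S).mulVec z = K.mulVec (U.mulVec z') := by
    rw [Matrix.mulVec_mulVec, ← hKU]
    ext i
    simp only [Matrix.mulVec, dotProduct]
    rw [hsum _ fun j hj => by simp [hout j hj]]
    simp only [hin, colSubmatrix, Matrix.submatrix_apply, id_eq]
  have h1 := h z' hout
  have h2 := hK (U.mulVec z')
  rw [hAz]
  rw [hzz] at h1
  have h3 := mul_le_mul_of_nonneg_left h1 (sq_nonneg (sigmaMin A))
  linarith

theorem mul_sigmaMin_sq_le_of_lt_card {K : Matrix (Fin n) (Fin n) ℝ} {U : Matrix (Fin n) (Fin m) ℝ}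
    (hKU : A = K * U)
    (hK : ∀ z : Fin n → ℝ, sigmaMin A ^ 2 * ∑ i, z i ^ 2 ≤ ∑ i, (K.transpose.mulVec z i) ^ 2)
    {S : Finset (Fin m)} (hn : 0 < n) (hS : n < S.card) {y : ℝ}
    (h : ∀ z : Fin n → ℝ, y * ∑ i, z i ^ 2 ≤ ∑ j ∈ S, (U.transpose.mulVec z j) ^ 2) :
    y * sigmaMin A ^ 2 ≤ sigmaMin (colSubmatrix A S) ^ 2 := by
  -- `hK` is multiplied by `y` below, which needs `y` nonnegative.
  rcases le_or_gt y 0 with hy | hy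
  · exact (mul_nonpos_of_nonpos_of_nonneg hy (sq_nonneg _)).trans (sq_nonneg _)
  have hne : Nonempty (Fin n) := ⟨⟨0, hn⟩⟩
  have e : sigmaMin (colSubmatrix A S) = minNormOnSphere (colSubmatrix A S).transpose := by
    rw [sigmaMin, if_neg (by simpa using hS)]
  rw [e]
  refine le_minNormOnSphere_sq _ fun z => ?_
  have hAz : ∀ j : S, (colSubmatrix A S).transpose.mulVec z j =
      U.transpose.mulVec (K.transpose.mulVec z) j := by
    intro j
    rw [Matrix.mulVec_mulVec, ← Matrix.transpose_mul, ← hKU]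
    rfl
  simp only [hAz]
  rw [Finset.sum_coe_sort S fun j => U.transpose.mulVec (K.transpose.mulVec z) j ^ 2]
  have h1 := h (K.transpose.mulVec z)
  have h2 := mul_le_mul_of_nonneg_left (hK z) hy.le
  linarith

end Reduction

/-! ### Passage to the exact bound, and assembly. -/

/-- A subset maximizing `f` among the finitely many of size `k` serves every y < g at once, so y can
tend to g. -/
theorem exists_finset_card_mul_le {m k : ℕ} (f : Finset (Fin m) → ℝ) {g c : ℝ} (hc : 0 ≤ c)
    (h : ∀ y < g, ∃ S : Finset (Fin m), S.card = k ∧ y * c ≤ f S) :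
    ∃ S : Finset (Fin m), S.card = k ∧ g * c ≤ f S := by
  obtain ⟨S₁, hS₁, -⟩ := h (g - 1) (by linarith)
  obtain ⟨S, hS, hmax⟩ := Finset.exists_max_image (Finset.powersetCard k Finset.univ) f
    ⟨S₁, Finset.mem_powersetCard_univ.2 hS₁⟩
  refine ⟨S, Finset.mem_powersetCard_univ.1 hS, ?_⟩
  have hle : ∀ y < g, y * c ≤ f S := fun y hy => by
    obtain ⟨T, hT, hy⟩ := h y hy
    exact hy.trans (hmax T (Finset.mem_powersetCard_univ.2 hT))
  rcases hc.eq_or_lt with h0 | h0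
  · simpa [← h0] using hle (g - 1) (by linarith)
  · rw [← le_div_iff₀ h0]
    exact le_of_forall_lt_imp_le_of_dense fun y hy => (le_div_iff₀ h0).2 (hle y hy)

theorem theorem1p5 (n m k : ℕ) (A : Matrix (Fin n) (Fin m) ℝ) (hA : A.rank = n)
    (hkm : k ≤ m) :
    ∃ S₀ : Finset (Fin m), S₀.card = k ∧
      (k = 2 → k ≤ n → g1 m n * sigmaMin A ^ 2 ≤ sigmaMin (colSubmatrix A S₀) ^ 2) ∧
      (k = 3 → k ≤ n → g2 m n * sigmaMin A ^ 2 ≤ sigmaMin (colSubmatrix A S₀) ^ 2) ∧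
      (n = 2 → n ≤ k → g1 m k * sigmaMin A ^ 2 ≤ sigmaMin (colSubmatrix A S₀) ^ 2) ∧
      (n = 3 → n ≤ k → g2 m k * sigmaMin A ^ 2 ≤ sigmaMin (colSubmatrix A S₀) ^ 2) := by
  have hnm : n ≤ m := hA ▸ A.rank_le_width
  obtain ⟨K, U, hKU, hU, hKt, hK⟩ := exists_factorization hA
  have reduce := fun g => exists_finset_card_mul_le (k := k) (g := g)
    (fun S => sigmaMin (colSubmatrix A S) ^ 2) (sq_nonneg (sigmaMin A))
  by_cases h2 : k = 2 ∧ k ≤ n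
  · obtain ⟨rfl, hkn⟩ := h2
    obtain ⟨S, hS, h⟩ := reduce (g1 m n) fun y hy => by
      obtain ⟨S, hS, h⟩ := exists_two_columns hkn hnm hU hy
      exact ⟨S, hS, mul_sigmaMin_sq_le_of_card_le hKU hK (by omega) (by omega) h⟩
    refine ⟨S, hS, fun _ _ => h, fun h' => by omega, fun h' _ => ?_, fun _ _ => by omega⟩
    subst h'; exact h
  by_cases h3 : k = 3 ∧ k ≤ n
  · obtain ⟨rfl, hkn⟩ := h3
    obtain ⟨S, hS, h⟩ := reduce (g2 m n) fun y hy => by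
      obtain ⟨S, hS, h⟩ := exists_three_columns hkn hnm hU hy
      exact ⟨S, hS, mul_sigmaMin_sq_le_of_card_le hKU hK (by omega) (by omega) h⟩
    refine ⟨S, hS, fun h' => by omega, fun _ _ => h, fun _ _ => by omega, fun h' _ => ?_⟩
    subst h'; exact h
  -- The cases k = n = 2 and k = n = 3 fell under `h2` and `h3`, so n < k from here on, as the
  -- transposed branch of `sigmaMin` requires.
  by_cases h4 : n = 2 ∧ n ≤ k
  · obtain ⟨rfl, hnk⟩ := h4
    obtain ⟨S, hS, h⟩ := reduce (g1 m k) fun y hy => by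
      obtain ⟨S, hS, h⟩ := exists_columns_of_two_rows hU hnk hkm hy
      exact ⟨S, hS, mul_sigmaMin_sq_le_of_lt_card hKU hKt (by omega) (by omega) h⟩
    exact ⟨S, hS, fun _ _ => by omega, fun _ _ => by omega, fun _ _ => h, fun _ => by omega⟩
  by_cases h5 : n = 3 ∧ n ≤ k
  · obtain ⟨rfl, hnk⟩ := h5
    obtain ⟨S, hS, h⟩ := reduce (g2 m k) fun y hy => by
      obtain ⟨S, hS, h⟩ := exists_columns_of_three_rows hU hnk hkm hy
      exact ⟨S, hS, mul_sigmaMin_sq_le_of_lt_card hKU hKt (by omega) (by omega) h⟩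
    exact ⟨S, hS, fun _ _ => by omega, fun _ _ => by omega, fun _ => by omega, fun _ _ => h⟩
  obtain ⟨S, -, hS⟩ := Finset.exists_subset_card_eq (s := (Finset.univ : Finset (Fin m)))
    (n := k) (by simpa using hkm)
  exact ⟨S, hS, fun a b => (h2 ⟨a, b⟩).elim, fun a b => (h3 ⟨a, b⟩).elim,
    fun a b => (h4 ⟨a, b⟩).elim, fun a b => (h5 ⟨a, b⟩).elim⟩
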